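/- Let $X$ be a real or complex Banach space and let $A : X \to X$ be a bounded linear operator of positive type, i.e. there is a finite $\kappa > 0$ such that, for every real $\alpha > 0$, the operator $A + \alpha I$ is one-to-one and onto with $\|(A+\alpha I)^{-1}\| \le \kappa/\alpha$. The fractional powers of $A$ are defined by $$A^q u = \frac{\sin \pi q}{\pi} \int_0^\infty s^{q-1} (A+sI)^{-1} A u \, ds \quad (0<q<1), \qquad A^q = A^{q-\lfloor q\rfloor} A^{\lfloor q \rfloor} \quad (q \ge 0), \qquad A^0 = I,$$ and $\log A$ is the operator $(\log A)u = \lim_{q \downarrow 0} \frac1q (A^q u - u)$, whose domain $\mathcal D(\log A)$ consists of all $u \in X$ for which this limit exists; powers $(\log A)^\nu$ have their natural domains. Fix a real number $p \ge 0$, an integer $\nu \ge 1$, a real number $\lambda > \log \|A\|$, and $0 < \delta_0 < 1$. Then there is a finite constant $C > 0$, which may depend on $A, p, \nu, \lambda, \delta_0$ only, such that for every $u \in X$ of the form $u = A^p v$ with $v \in \mathcal D((\log A)^\nu)$ and with $\|Au\| \le \delta_0$ we have $$\|u\| \le C \, \max\{\|w\|, 1\} \, \|Au\|^{\frac{p}{p+1}}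 \Big(\log \frac{1}{\|Au\|}\Big)^{-\frac{\nu}{p+1}}, \qquad w = (\lambda I - \log A)^\nu v,$$ where the right-hand side is read as $0$ if $Au = 0$. -/

import Mathlib

open Filter Topology MeasureTheory

noncomputable section

/-- A bounded linear operator `A` on a Banach space is of positive type if, for some finite
`κ > 0` and all real `α > 0`, the operator `A + α I` is one-to-one and onto and its inverse
satisfies `‖(A + α I)⁻¹‖ ≤ κ / α`. (By the open mapping theorem, a bijective `A + α I` is a unit
of the algebra of bounded operators, so `Ring.inverse` is its genuine inverse.) -/
def IsPositiveType {𝕜 X : Type*} [RCLike 𝕜] [NormedAddCommGroup X] [NormedSpace 𝕜 X]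
    (A : X →L[𝕜] X) : Prop :=
  ∃ κ : ℝ, 0 < κ ∧ ∀ α : ℝ, 0 < α →
    Function.Bijective (A + (α : 𝕜) • (1 : X →L[𝕜] X)) ∧
      ‖Ring.inverse (A + (α : 𝕜) • (1 : X →L[𝕜] X))‖ ≤ κ / α

/-- The Balakrishnan integral
`(sin (π r) / π) ∫₀^∞ s ^ (r - 1) (A + s I)⁻¹ A u ds`, for `0 < r < 1`. -/
def balakrishnan {𝕜 X : Type*} [RCLike 𝕜] [NormedAddCommGroup X] [NormedSpace 𝕜 X]
    [NormedSpace ℝ X] (A : X →L[𝕜] X) (r : ℝ) (u : X) : X :=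
  (Real.sin (Real.pi * r) / Real.pi) •
    ∫ s in Set.Ioi (0 : ℝ),
      s ^ (r - 1) • Ring.inverse (A + (s : 𝕜) • (1 : X →L[𝕜] X)) (A u)

/-- The fractional power `A ^ q`, for real `q ≥ 0`, applied to `u`: it is
`A ^ (q - ⌊q⌋) A ^ ⌊q⌋ u`, where the power with exponent in `(0, 1)` is the Balakrishnan
integral, and `A ^ 0 = I`. -/
def fracPow {𝕜 X : Type*} [RCLike 𝕜] [NormedAddCommGroup X] [NormedSpace 𝕜 X]
    [NormedSpace ℝ X] (A : X →L[𝕜] X) (q : ℝ) (u : X) : X :=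
  open Classical in
  if Int.fract q = 0 then (A ^ ⌊q⌋₊) u
  else balakrishnan A (Int.fract q) ((A ^ ⌊q⌋₊) u)

/-- The difference quotient `(A ^ q u - u) / q`. -/
def logQuotient {𝕜 X : Type*} [RCLike 𝕜] [NormedAddCommGroup X] [NormedSpace 𝕜 X]
    [NormedSpace ℝ X] (A : X →L[𝕜] X) (u : X) (q : ℝ) : X :=
  q⁻¹ • (fracPow A q u - u)

/-- The domain of `log A`: all `u` for which `(A ^ q u - u) / q` has a limit as `q ↓ 0`. -/
def logDomain {𝕜 X : Type*} [RCLike 𝕜] [NormedAddCommGroup X] [NormedSpace 𝕜 X]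
    [NormedSpace ℝ X] (A : X →L[𝕜] X) : Set X :=
  {u | ∃ y : X, Tendsto (logQuotient A u) (𝓝[>] 0) (𝓝 y)}

/-- The operator `log A`, `(log A) u = lim_{q ↓ 0} (A ^ q u - u) / q`; only its values on
`logDomain A` are meaningful. -/
def logOp {𝕜 X : Type*} [RCLike 𝕜] [NormedAddCommGroup X] [NormedSpace 𝕜 X]
    [NormedSpace ℝ X] (A : X →L[𝕜] X) (u : X) : X :=
  limUnder (𝓝[>] (0 : ℝ)) (logQuotient A u)

/-- The domain of the power `(log A) ^ n`. -/
def logPowDomain {𝕜 X : Type*} [RCLike 𝕜] [NormedAddCommGroup X] [NormedSpace 𝕜 X]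
    [NormedSpace ℝ X] (A : X →L[𝕜] X) : ℕ → Set X
  | 0 => Set.univ
  | n + 1 => {u | u ∈ logDomain A ∧ logOp A u ∈ logPowDomain A n}

/-- The source element `w = (lam I - log A) ^ n v`, for `v` in the domain of `(log A) ^ n`
(which is also the domain of `(lam I - log A) ^ n`). -/
def sourceElement {𝕜 X : Type*} [RCLike 𝕜] [NormedAddCommGroup X] [NormedSpace 𝕜 X]
    [NormedSpace ℝ X] (A : X →L[𝕜] X) (lam : ℝ) (n : ℕ) (v : X) : X :=
  (fun x : X => lam • x - logOp A x)^[n] v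

end

/-!
Powers of `A` are handled in the real Banach algebra of bounded operators. The proof has four
ingredients.

*The exponent law* `A ^ (p + q) = A ^ p A ^ q` (`IsPositiveTypeWith.realPow_add`). For `ε > 0` the
element `a + ε` is joined to `1` by a path `b` of invertible elements of positive type. Along the
path, differentiation under the Balakrishnan integral and one integration by parts show that
`y = b ^ q` solves `y' = q b' b⁻¹ y`. Hence `b ^ (p + q)` and `b ^ p b ^ q` solve the same linear
equation; they agree at the element `1`, where the Balakrishnan integral is a Beta integral, and
so they agree at `a + ε`. Letting `ε ↓ 0` gives the law for `a` itself.

*The moment inequality* (`IsPositiveTypeWith.norm_realPow_mul_le`). If `‖x‖ ≤ N` and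
`‖a x‖ ≤ N α`, then `‖a ^ t x‖ ≤ (1 + 2 κ) N α ^ t` for `0 < t < 1`, and similarly for larger
exponents. It yields the exponential growth of the semigroup `A ^ t`, and the size
`‖A ^ q K‖ ≤ C α ^ q` on the cut-off `K = (α (A + α)⁻¹) ^ m` (`cutoff`).

*The inverse of `lam - log A`* (`norm_orbit_le_of_sourceElement`). For `v` in the domain of
`log A`, the orbit `e ^ (-lam t) A ^ t v` has right derivative
`-e ^ (-lam t) A ^ t (lam - log A) v` and tends to `0` because `lam > log ‖A‖`. A decay
estimate for the orbit of `(lam - log A) ^ n v` can therefore be integrated `n` times from `t`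
to `∞`. On the range of the cut-off the decay rate is `ℓ = log (1 / α)`, which produces the
factor `ℓ ^ (-n)`.

*Interpolation.* Writing `u = K u + (1 - K) u`, where `1 - K` is divisible by `A` with a quotient of
size `1 / α`, one obtains `‖u‖ ≤ C (α ^ p ℓ ^ (-n) ‖w‖ + ‖A u‖ / α)` for all `0 < α < 1`, and
`exists_const_of_interpolation` chooses `α`.
-/

/-! ### Scalar integrals -/

/-- A majorant for Balakrishnan-type integrands: a kernel bounded by `P` near `0` and by `Q / s`
near `∞`, against the weight `s ^ (t - 1)`. -/
noncomputable def kernelMajorant (t P Q s : ℝ) : ℝ := s ^ (t - 1) * min P (Q / s)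

lemma kernelMajorant_le_left {t P Q s : ℝ} (hs : 0 < s) :
    kernelMajorant t P Q s ≤ P * s ^ (t - 1) := by
  rw [kernelMajorant, mul_comm]
  exact mul_le_mul_of_nonneg_right (min_le_left _ _) (Real.rpow_nonneg hs.le _)

lemma kernelMajorant_le_right {t P Q s : ℝ} (hs : 0 < s) :
    kernelMajorant t P Q s ≤ Q * s ^ (t - 2) := by
  have h : s ^ (t - 1) = s ^ (t - 2) * s := by
    rw [show t - 1 = (t - 2) + 1 by ring, Real.rpow_add_one hs.ne']
  calc kernelMajorant t P Q s ≤ s ^ (t - 1) * (Q / s) :=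
        mul_le_mul_of_nonneg_left (min_le_right _ _) (Real.rpow_nonneg hs.le _)
    _ = Q * s ^ (t - 2) := by rw [h]; field_simp

lemma integrableOn_kernelMajorant {t P Q : ℝ} (ht : 0 < t) (ht' : t < 1) (hP : 0 ≤ P)
    (hQ : 0 ≤ Q) : IntegrableOn (kernelMajorant t P Q) (Set.Ioi 0) := by
  have hmeas : Measurable (kernelMajorant t P Q) := by
    unfold kernelMajorant; fun_prop
  have h0 : ∀ s, 0 < s → ‖kernelMajorant t P Q s‖ = kernelMajorant t P Q s := fun s hs =>
    Real.norm_of_nonneg (mul_nonneg (Real.rpow_nonneg hs.le _) (le_min hP (by positivity)))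
  rw [← Set.Ioc_union_Ioi_eq_Ioi (zero_le_one' ℝ)]
  refine IntegrableOn.union ?_ ?_
  · have hi : IntegrableOn (fun s : ℝ => P * s ^ (t - 1)) (Set.Ioc 0 1) := by
      have := intervalIntegral.intervalIntegrable_rpow' (a := 0) (b := 1) (r := t - 1)
        (by linarith)
      exact ((intervalIntegrable_iff_integrableOn_Ioc_of_le zero_le_one).1 this).const_mul P
    refine Integrable.mono' hi hmeas.aestronglyMeasurable ?_
    refine ae_restrict_of_forall_mem measurableSet_Ioc fun s hs => ?_
    rw [h0 s hs.1]
    exact kernelMajorant_le_left hs.1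
  · have hi : IntegrableOn (fun s : ℝ => Q * s ^ (t - 2)) (Set.Ioi 1) :=
      (integrableOn_Ioi_rpow_of_lt (by linarith) one_pos).const_mul Q
    refine Integrable.mono' hi hmeas.aestronglyMeasurable ?_
    refine ae_restrict_of_forall_mem measurableSet_Ioi fun s hs => ?_
    have hs : (1 : ℝ) < s := hs
    rw [h0 s (by linarith)]
    exact kernelMajorant_le_right (by linarith)

/-- Obtained by splitting the integral at `s = α`, where the bounds `P` and `Q α / s` have the same
order of magnitude. -/
lemma integral_kernelMajorant_le {t P Q α : ℝ} (ht : 0 < t) (ht' : t < 1) (hP : 0 ≤ P)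
    (hQ : 0 ≤ Q) (hα : 0 < α) :
    ∫ s in Set.Ioi 0, kernelMajorant t P (Q * α) s ≤ α ^ t * (P / t + Q / (1 - t)) := by
  have hint := integrableOn_kernelMajorant ht ht' hP (mul_nonneg hQ hα.le)
  rw [← Set.Ioc_union_Ioi_eq_Ioi hα.le] at hint ⊢
  rw [setIntegral_union (Set.Ioc_disjoint_Ioi le_rfl) measurableSet_Ioi hint.left_of_union
    hint.right_of_union, mul_add]
  refine add_le_add ?_ ?_
  · have hi : IntegrableOn (fun s : ℝ => P * s ^ (t - 1)) (Set.Ioc 0 α) := by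
      have := intervalIntegral.intervalIntegrable_rpow' (a := 0) (b := α) (r := t - 1)
        (by linarith)
      exact ((intervalIntegrable_iff_integrableOn_Ioc_of_le hα.le).1 this).const_mul P
    refine (setIntegral_mono_on hint.left_of_union hi measurableSet_Ioc
      fun s hs => kernelMajorant_le_left hs.1).trans_eq ?_
    rw [← intervalIntegral.integral_of_le hα.le, intervalIntegral.integral_const_mul,
      integral_rpow (Or.inl (by linarith)), sub_add_cancel, Real.zero_rpow ht.ne']
    ring
  · have hi : IntegrableOn (fun s : ℝ => (Q * α) * s ^ (t - 2)) (Set.Ioi α) :=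
      (integrableOn_Ioi_rpow_of_lt (by linarith) hα).const_mul _
    refine (setIntegral_mono_on hint.right_of_union hi measurableSet_Ioi
      fun s hs => kernelMajorant_le_right (hα.trans hs)).trans_eq ?_
    rw [integral_const_mul, integral_Ioi_rpow_of_lt (by linarith) hα,
      show t - 2 + 1 = t - 1 by ring, Real.rpow_sub_one hα.ne']
    have : t - 1 ≠ 0 := by linarith
    have : 1 - t ≠ 0 := by linarith
    field_simp
    ring

/-- The Beta integral `∫₀^∞ s ^ (t - 1) / (1 + s) ds = π / sin (π t)`. -/
lemma integral_Ioi_rpow_div_one_add {t : ℝ} (ht : 0 < t) (ht' : t < 1) :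
    ∫ s in Set.Ioi (0 : ℝ), s ^ (t - 1) / (1 + s) = Real.pi / Real.sin (Real.pi * t) := by
  have hbeta : ∫ x in Set.Ioo (0 : ℝ) 1, x ^ (t - 1) * (1 - x) ^ (-t) =
      Real.pi / Real.sin (Real.pi * t) := by
    have h1 := ProbabilityTheory.beta_eq_betaIntegralReal t (1 - t) ht (by linarith)
    rw [ProbabilityTheory.beta, add_sub_cancel, Real.Gamma_one, div_one,
      Real.Gamma_mul_Gamma_one_sub] at h1
    rw [h1, Complex.betaIntegral]
    have h2 : (∫ x : ℝ in (0 : ℝ)..1, (x : ℂ) ^ ((t : ℂ) - 1) *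
        (1 - (x : ℂ)) ^ (((1 - t : ℝ) : ℂ) - 1)) =
        ((∫ x in (0 : ℝ)..1, x ^ (t - 1) * (1 - x) ^ (-t) : ℝ) : ℂ) := by
      rw [← intervalIntegral.integral_ofReal]
      refine intervalIntegral.integral_congr fun x hx => ?_
      rw [Set.uIcc_of_le zero_le_one] at hx
      rw [show (t : ℂ) - 1 = ((t - 1 : ℝ) : ℂ) by push_cast; ring,
        show (((1 - t : ℝ) : ℂ) - 1) = ((-t : ℝ) : ℂ) by push_cast; ring,
        show (1 : ℂ) - x = ((1 - x : ℝ) : ℂ) by push_cast; ring,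
        ← Complex.ofReal_cpow hx.1, ← Complex.ofReal_cpow (by linarith [hx.2])]
      push_cast; ring
    rw [h2, Complex.ofReal_re, intervalIntegral.integral_of_le zero_le_one,
      integral_Ioc_eq_integral_Ioo]
  have himg : (fun s : ℝ => s / (1 + s)) '' Set.Ioi 0 = Set.Ioo 0 1 := by
    ext x
    constructor
    · rintro ⟨s, hs, rfl⟩
      have hs : 0 < s := hs
      refine ⟨by positivity, ?_⟩
      simp only
      rw [div_lt_one (by linarith)]; linarith
    · rintro ⟨hx0, hx1⟩
      have : 0 < 1 - x := by linarith
      refine ⟨x / (1 - x), div_pos hx0 this, ?_⟩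
      simp only
      field_simp
      ring
  have hder : ∀ s ∈ Set.Ioi (0 : ℝ), HasDerivWithinAt (fun s : ℝ => s / (1 + s))
      (1 / (1 + s) ^ 2) (Set.Ioi 0) s := by
    intro s hs
    have hs : 0 < s := hs
    have h := (hasDerivAt_id s).div ((hasDerivAt_id s).const_add 1) (by simp; linarith)
    refine (h.congr_deriv ?_).hasDerivWithinAt
    simp
  have hinj : Set.InjOn (fun s : ℝ => s / (1 + s)) (Set.Ioi 0) := by
    intro x hx y hy hxy
    have hx : 0 < x := hx
    have hy : 0 < y := hy
    simp only at hxy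
    rw [div_eq_div_iff (by linarith) (by linarith)] at hxy
    linarith
  rw [← hbeta, ← himg, integral_image_eq_integral_abs_deriv_smul measurableSet_Ioi hder hinj]
  refine setIntegral_congr_fun measurableSet_Ioi fun s hs => ?_
  have hs : 0 < s := hs
  have h1s : 0 < 1 + s := by linarith
  have e1 : 1 - s / (1 + s) = (1 + s)⁻¹ := by field_simp; ring
  simp only [smul_eq_mul]
  rw [e1, Real.div_rpow hs.le h1s.le, Real.inv_rpow h1s.le, Real.rpow_neg h1s.le, inv_inv,
    abs_of_nonneg (by positivity), Real.rpow_sub_one h1s.ne']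
  have : 0 < (1 + s) ^ t := Real.rpow_pos_of_pos h1s t
  field_simp

/-! ### Fractional powers along a path of invertible elements -/

section BanachAlgebra

variable {𝓐 : Type*} [NormedRing 𝓐] [NormedAlgebra ℝ 𝓐]

/-- The resolvent `(a + s)⁻¹`, with the junk value `0` where `a + s` is not a unit. -/
noncomputable def res (a : 𝓐) (s : ℝ) : 𝓐 := Ring.inverse (a + s • (1 : 𝓐))

lemma res_mul_cancel {a : 𝓐} {s : ℝ} (h : IsUnit (a + s • (1 : 𝓐))) :
    res a s * (a + s • (1 : 𝓐)) = 1 := Ring.inverse_mul_cancel _ h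

lemma res_mul_self {a : 𝓐} {s : ℝ} (h : IsUnit (a + s • (1 : 𝓐))) :
    res a s * a = 1 - s • res a s := by
  have := res_mul_cancel h
  rw [mul_add, mul_smul_comm, mul_one] at this
  rw [← this]; abel

lemma Commute.ringInverse {M : Type*} [MonoidWithZero M] {x y : M} (h : Commute x y) :
    Commute x (Ring.inverse y) := by
  by_cases hy : IsUnit y
  · obtain ⟨u, rfl⟩ := hy
    rw [Ring.inverse_unit]
    exact h.units_inv_right
  · rw [Ring.inverse_non_unit _ hy]
    exact Commute.zero_right _

lemma Commute.res {x a : 𝓐} (h : Commute x a) (s : ℝ) : Commute x (res a s) :=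
  (h.add_right ((Commute.one_right x).smul_right s)).ringInverse

lemma commute_res (a : 𝓐) (s : ℝ) : Commute a (res a s) := (Commute.refl a).res s

/-- The Balakrishnan fractional power `a ^ t`, `0 < t < 1`, as an element of the algebra. -/
noncomputable def balakrishnanPow (a : 𝓐) (t : ℝ) : 𝓐 :=
  (Real.sin (Real.pi * t) / Real.pi) • ∫ s in Set.Ioi (0 : ℝ), s ^ (t - 1) • (res a s * a)

/-- The fractional power `a ^ q`, `q ≥ 0`, as an element of the algebra. -/
noncomputable def realPow (a : 𝓐) (q : ℝ) : 𝓐 :=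
  open Classical in
  if Int.fract q = 0 then a ^ ⌊q⌋₊ else balakrishnanPow a (Int.fract q) * a ^ ⌊q⌋₊

lemma continuousOn_rpow_Ioi (r : ℝ) : ContinuousOn (fun s : ℝ => s ^ r) (Set.Ioi 0) :=
  fun _ hs => (Real.continuousAt_rpow_const _ _ (Or.inl (ne_of_gt hs))).continuousWithinAt

/-- Integrability of a Balakrishnan-type integrand whose kernel is bounded near `0` and
`O(1 / s)` near `∞`. -/
lemma integrableOn_rpow_smul_of_norm_le {f : ℝ → 𝓐} {t P Q : ℝ} (ht : 0 < t) (ht' : t < 1)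
    (hf : ContinuousOn f (Set.Ioi 0)) (hP : ∀ s, 0 < s → ‖f s‖ ≤ P)
    (hQ : ∀ s, 0 < s → ‖f s‖ ≤ Q / s) :
    IntegrableOn (fun s : ℝ => s ^ (t - 1) • f s) (Set.Ioi 0) ∧
      ∀ s, 0 < s → ‖s ^ (t - 1) • f s‖ ≤ kernelMajorant t P Q s := by
  have hP0 : 0 ≤ P := (norm_nonneg _).trans (hP 1 one_pos)
  have hQ0 : 0 ≤ Q := by simpa using (norm_nonneg _).trans (hQ 1 one_pos)
  have hb : ∀ s, 0 < s → ‖s ^ (t - 1) • f s‖ ≤ kernelMajorant t P Q s := by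
    intro s hs
    rw [norm_smul, Real.norm_of_nonneg (Real.rpow_nonneg hs.le _), kernelMajorant]
    exact mul_le_mul_of_nonneg_left (le_min (hP s hs) (hQ s hs)) (Real.rpow_nonneg hs.le _)
  refine ⟨Integrable.mono' (integrableOn_kernelMajorant ht ht' hP0 hQ0)
    (((continuousOn_rpow_Ioi _).smul hf).aestronglyMeasurable measurableSet_Ioi)
    (ae_restrict_of_forall_mem measurableSet_Ioi fun s hs => hb s hs), hb⟩

lemma hasDerivAt_ringInverse [CompleteSpace 𝓐] {f : ℝ → 𝓐} {f' : 𝓐} {x : ℝ}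
    (hf : HasDerivAt f f' x) (hu : IsUnit (f x)) :
    HasDerivAt (fun τ => Ring.inverse (f τ))
      (-(Ring.inverse (f x) * f' * Ring.inverse (f x))) x := by
  obtain ⟨u, hu⟩ := hu
  have h := hasFDerivAt_ringInverse (𝕜 := ℝ) u
  rw [hu] at h
  have := h.comp_hasDerivAt x hf
  rw [← hu, Ring.inverse_unit]
  exact this

section Bounds

variable [CompleteSpace 𝓐] {a : 𝓐}

lemma hasDerivAt_res {s : ℝ} (hu : IsUnit (a + s • (1 : 𝓐))) :
    HasDerivAt (res a) (-(res a s * res a s)) s := by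
  have h : HasDerivAt (fun s : ℝ => a + s • (1 : 𝓐)) (1 : 𝓐) s := by
    simpa using ((hasDerivAt_id s).smul_const (1 : 𝓐)).const_add a
  have h' := hasDerivAt_ringInverse h hu
  rw [mul_one] at h'
  exact h'

lemma continuousOn_res (hu : ∀ s : ℝ, 0 < s → IsUnit (a + s • (1 : 𝓐))) :
    ContinuousOn (res a) (Set.Ioi 0) :=
  fun s hs => (hasDerivAt_res (hu s hs)).continuousAt.continuousWithinAt

end Bounds

section Path

/-- A differentiable path `b` in the algebra, with derivative `b'`, that commutes with its own
derivative and is of positive type uniformly, with `0` in the resolvent set. -/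
structure IsPositivePath (b b' : ℝ → 𝓐) (K c : ℝ) : Prop where
  hasDerivAt : ∀ τ, HasDerivAt b (b' τ) τ
  continuous_deriv : Continuous b'
  commute : ∀ τ, Commute (b' τ) (b τ)
  pos : 0 < c
  isUnit : ∀ τ s : ℝ, 0 ≤ s → IsUnit (b τ + s • (1 : 𝓐))
  norm_res_le : ∀ τ s : ℝ, 0 ≤ s → ‖res (b τ) s‖ ≤ K / (c + s)

namespace IsPositivePath

variable {b b' : ℝ → 𝓐} {K c : ℝ}

lemma const_nonneg (h : IsPositivePath b b' K c) : 0 ≤ K := by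
  have h1 := (norm_nonneg _).trans (h.norm_res_le 0 0 le_rfl)
  have h2 := h.pos
  rw [add_zero] at h1
  by_contra hK
  exact absurd h1 (not_le.2 (div_neg_of_neg_of_pos (not_le.1 hK) h2))

lemma norm_res_le_left (h : IsPositivePath b b' K c) (τ : ℝ) {s : ℝ} (hs : 0 ≤ s) :
    ‖res (b τ) s‖ ≤ K / c :=
  (h.norm_res_le τ s hs).trans
    (div_le_div_of_nonneg_left h.const_nonneg h.pos (by linarith))

lemma norm_res_le_right (h : IsPositivePath b b' K c) (τ : ℝ) {s : ℝ} (hs : 0 < s) :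
    ‖res (b τ) s‖ ≤ K / s :=
  (h.norm_res_le τ s hs.le).trans
    (div_le_div_of_nonneg_left h.const_nonneg hs (by linarith [h.pos]))

/-- The kernel of the `τ`-derivative of the Balakrishnan integrand has the same decay as the
resolvent itself, since `s / (c + s) ^ 2 ≤ min (1 / c) (1 / s)`. -/
lemma norm_smul_res_mul_res_le (h : IsPositivePath b b' K c) (τ : ℝ) {s : ℝ} (hs : 0 < s)
    {d : 𝓐} {D : ℝ} (hd : ‖d‖ ≤ D) :
    ‖s • (res (b τ) s * d * res (b τ) s)‖ ≤ K * D * K / c ∧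
      ‖s • (res (b τ) s * d * res (b τ) s)‖ ≤ K * D * K / s := by
  have hc := h.pos
  have hK := h.const_nonneg
  have hD : 0 ≤ D := (norm_nonneg _).trans hd
  have h1 : ‖s • (res (b τ) s * d * res (b τ) s)‖ ≤ s * (K / (c + s) * D * (K / (c + s))) := by
    rw [norm_smul, Real.norm_of_nonneg hs.le]
    refine mul_le_mul_of_nonneg_left ?_ hs.le
    have hr := h.norm_res_le τ s hs.le
    refine (norm_mul_le _ _).trans (mul_le_mul ((norm_mul_le _ _).trans
      (mul_le_mul hr hd (norm_nonneg _) (by positivity))) hr (norm_nonneg _) (by positivity))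
  have h2 : s * (K / (c + s) * D * (K / (c + s))) = K * D * K * (s / (c + s) / (c + s)) := by
    field_simp
  have h3 : s / (c + s) / (c + s) ≤ 1 / (c + s) := by
    gcongr
    rw [div_le_one (by positivity)]
    linarith
  have h4 : (1 : ℝ) / (c + s) ≤ 1 / c := by gcongr; linarith
  have h5 : (1 : ℝ) / (c + s) ≤ 1 / s := by gcongr; linarith
  have hKD : 0 ≤ K * D * K := by positivity
  rw [h2] at h1
  constructor
  · refine h1.trans ?_
    rw [div_eq_mul_one_div (K * D * K) c]
    exact mul_le_mul_of_nonneg_left (h3.trans h4) hKD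
  · refine h1.trans ?_
    rw [div_eq_mul_one_div (K * D * K) s]
    exact mul_le_mul_of_nonneg_left (h3.trans h5) hKD

variable [CompleteSpace 𝓐]

lemma continuousOn_res (h : IsPositivePath b b' K c) (τ : ℝ) :
    ContinuousOn (res (b τ)) (Set.Ioi 0) :=
  _root_.continuousOn_res fun s hs => h.isUnit τ s hs.le

lemma integrableOn_res (h : IsPositivePath b b' K c) (τ : ℝ) {t : ℝ} (ht : 0 < t) (ht' : t < 1) :
    IntegrableOn (fun s : ℝ => s ^ (t - 1) • res (b τ) s) (Set.Ioi 0) :=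
  (integrableOn_rpow_smul_of_norm_le ht ht' (h.continuousOn_res τ)
    (fun _ hs => h.norm_res_le_left τ hs.le) (fun _ hs => h.norm_res_le_right τ hs)).1

/-- Integration by parts:
`∫₀^∞ s ^ t (b + s)⁻² ds = t ∫₀^∞ s ^ (t - 1) (b + s)⁻¹ ds`. -/
lemma integral_rpow_smul_res_sq (h : IsPositivePath b b' K c) (τ : ℝ) {t : ℝ} (ht : 0 < t)
    (ht' : t < 1) :
    IntegrableOn (fun s : ℝ => s ^ (t - 1) • s • (res (b τ) s * res (b τ) s)) (Set.Ioi 0) ∧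
    ∫ s in Set.Ioi (0 : ℝ), s ^ (t - 1) • s • (res (b τ) s * res (b τ) s) =
      t • ∫ s in Set.Ioi (0 : ℝ), s ^ (t - 1) • res (b τ) s := by
  have hi2 : IntegrableOn (fun s : ℝ => s ^ (t - 1) • s • (res (b τ) s * res (b τ) s))
      (Set.Ioi 0) := by
    have hb := fun s (hs : 0 < s) => h.norm_smul_res_mul_res_le τ hs (d := 1) le_rfl
    simp only [mul_one] at hb
    exact (integrableOn_rpow_smul_of_norm_le ht ht'
      (continuousOn_id.smul ((h.continuousOn_res τ).mul (h.continuousOn_res τ)))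
      (fun s hs => (hb s hs).1) (fun s hs => (hb s hs).2)).1
  refine ⟨hi2, ?_⟩
  have hi1 := h.integrableOn_res τ ht ht'
  have hder : ∀ s ∈ Set.Ioi (0 : ℝ), HasDerivAt (fun s : ℝ => s ^ t • res (b τ) s)
      (t • s ^ (t - 1) • res (b τ) s - s ^ (t - 1) • s • (res (b τ) s * res (b τ) s)) s := by
    intro s hs
    have hs : 0 < s := hs
    have h1 := (Real.hasDerivAt_rpow_const (p := t) (Or.inl hs.ne')).smul
      (hasDerivAt_res (h.isUnit τ s hs.le))
    refine h1.congr_deriv ?_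
    have h2 : s ^ t = s ^ (t - 1) * s := by
      rw [← Real.rpow_add_one hs.ne', sub_add_cancel]
    rw [h2, smul_neg, smul_smul, smul_smul]
    abel
  have hcont : ContinuousWithinAt (fun s : ℝ => s ^ t • res (b τ) s) (Set.Ici 0) 0 :=
    ((Real.continuousAt_rpow_const _ _ (Or.inr ht.le)).smul
      (hasDerivAt_res (h.isUnit τ 0 le_rfl)).continuousAt).continuousWithinAt
  have hlim : Tendsto (fun s : ℝ => s ^ t • res (b τ) s) atTop (𝓝 0) := by
    have h0 : Tendsto (fun s : ℝ => K * s ^ (-(1 - t))) atTop (𝓝 0) := by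
      simpa using (tendsto_rpow_neg_atTop (y := 1 - t) (by linarith)).const_mul K
    refine squeeze_zero_norm' ?_ h0
    filter_upwards [eventually_gt_atTop 0] with s hs
    rw [norm_smul, Real.norm_of_nonneg (Real.rpow_nonneg hs.le _),
      show -(1 - t) = t - 1 by ring, Real.rpow_sub_one hs.ne']
    calc s ^ t * ‖res (b τ) s‖ ≤ s ^ t * (K / s) :=
          mul_le_mul_of_nonneg_left (h.norm_res_le_right τ hs) (Real.rpow_nonneg hs.le _)
      _ = K * (s ^ t / s) := by ring
  have key := integral_Ioi_of_hasDerivAt_of_tendsto hcont hder ((hi1.smul t).sub hi2) hlim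
  have hsub := integral_sub (hi1.smul t) hi2
  simp only [Pi.smul_apply] at hsub
  rw [hsub, integral_smul] at key
  simp only [Real.zero_rpow ht.ne', zero_smul, sub_zero] at key
  exact (sub_eq_zero.1 key).symm

/-- Since `b` is invertible, the factor `b` of the Balakrishnan integrand can be taken out. -/
lemma balakrishnanPow_eq (h : IsPositivePath b b' K c) (τ : ℝ) {t : ℝ} (ht : 0 < t)
    (ht' : t < 1) :
    balakrishnanPow (b τ) t = (Real.sin (Real.pi * t) / Real.pi) •
      ((∫ s in Set.Ioi (0 : ℝ), s ^ (t - 1) • res (b τ) s) * b τ) := by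
  rw [balakrishnanPow, ← integral_mul_const_of_integrable (h.integrableOn_res τ ht ht')]
  simp only [smul_mul_assoc]

lemma hasDerivAt_balakrishnanPow (h : IsPositivePath b b' K c) (τ : ℝ) {t : ℝ} (ht : 0 < t)
    (ht' : t < 1) :
    HasDerivAt (fun τ => balakrishnanPow (b τ) t)
      (t • (b' τ * res (b τ) 0 * balakrishnanPow (b τ) t)) τ := by
  set D : ℝ := ‖b' τ‖ + 1
  have hnhds : {x | ‖b' x‖ < D} ∈ 𝓝 τ :=
    (h.continuous_deriv.norm.continuousAt (x := τ)).eventually_lt continuousAt_const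
      (lt_add_one _)
  have hK := h.const_nonneg
  have hc := h.pos
  have hmain := hasDerivAt_integral_of_dominated_loc_of_deriv_le
    (μ := volume.restrict (Set.Ioi (0 : ℝ))) (x₀ := τ) hnhds
    (F := fun x s => s ^ (t - 1) • (res (b x) s * b x))
    (F' := fun x s => s ^ (t - 1) • s • (res (b x) s * b' x * res (b x) s))
    (bound := kernelMajorant t (K * D * K / c) (K * D * K))
    (Eventually.of_forall fun x => ((continuousOn_rpow_Ioi _).smul
      ((h.continuousOn_res x).mul continuousOn_const)).aestronglyMeasurable measurableSet_Ioi)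
    (by
      have := (h.integrableOn_res τ ht ht').mul_const (b τ)
      simpa only [smul_mul_assoc] using this)
    (((continuousOn_rpow_Ioi _).smul (continuousOn_id.smul
      (((h.continuousOn_res τ).mul continuousOn_const).mul
        (h.continuousOn_res τ)))).aestronglyMeasurable measurableSet_Ioi)
    (ae_restrict_of_forall_mem measurableSet_Ioi fun s hs x hx => by
      have hs : 0 < s := hs
      have := h.norm_smul_res_mul_res_le x hs (le_of_lt hx)
      rw [norm_smul, Real.norm_of_nonneg (Real.rpow_nonneg hs.le _), kernelMajorant]
      exact mul_le_mul_of_nonneg_left (le_min this.1 this.2) (Real.rpow_nonneg hs.le _))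
    (integrableOn_kernelMajorant ht ht' (by positivity) (by positivity))
    (ae_restrict_of_forall_mem measurableSet_Ioi fun s hs x _ => by
      have hs : 0 < s := hs
      have hu := h.isUnit x s hs.le
      have h1 : HasDerivAt (fun x => res (b x) s) (-(res (b x) s * b' x * res (b x) s)) x :=
        hasDerivAt_ringInverse ((h.hasDerivAt x).add_const _) hu
      refine ((h1.mul (h.hasDerivAt x)).const_smul (s ^ (t - 1))).congr_deriv ?_
      congr 1
      rw [neg_mul, mul_assoc _ _ (b x), res_mul_self hu, mul_sub, mul_one, mul_smul_comm]
      abel)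
  have hcomm : ∀ s, Commute (b' τ) (res (b τ) s) := fun s => (h.commute τ).res s
  have hint : ∫ s in Set.Ioi (0 : ℝ), s ^ (t - 1) • s • (res (b τ) s * b' τ * res (b τ) s) =
      b' τ * t • ∫ s in Set.Ioi (0 : ℝ), s ^ (t - 1) • res (b τ) s := by
    obtain ⟨h1, h2⟩ := h.integral_rpow_smul_res_sq τ ht ht'
    rw [← h2, ← integral_const_mul_of_integrable h1]
    congr 1 with s
    rw [← (hcomm s).eq, mul_smul_comm, mul_smul_comm, mul_assoc]
  refine (hmain.2.const_smul (Real.sin (Real.pi * t) / Real.pi)).congr_deriv ?_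
  rw [hint, h.balakrishnanPow_eq τ ht ht']
  set J := ∫ s in Set.Ioi (0 : ℝ), s ^ (t - 1) • res (b τ) s with hJ
  have hJb : Commute (b τ) J := by
    have hi := h.integrableOn_res τ ht ht'
    rw [Commute, SemiconjBy, hJ, ← integral_const_mul_of_integrable hi,
      ← integral_mul_const_of_integrable hi]
    congr 1 with s
    rw [mul_smul_comm, smul_mul_assoc, (commute_res (b τ) s).eq]
  have hinv : res (b τ) 0 * b τ = 1 := by
    simpa using res_mul_self (h.isUnit τ 0 le_rfl)
  rw [← hJb.eq, mul_smul_comm, mul_smul_comm, smul_comm t, mul_assoc, ← mul_assoc (res (b τ) 0),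
    hinv, one_mul]

end IsPositivePath

end Path

end BanachAlgebra

/-! ### The exponent law for invertible elements of positive type -/

section Semigroup

variable {𝓐 : Type*} [NormedRing 𝓐] [NormedAlgebra ℝ 𝓐]

/-- The property that `y` solves the linear equation `y' = q b' b⁻¹ y` along the path `b`, and that
`y τ` commutes with everything that commutes with `b τ`. The equation determines `b ^ q` up to the
initial value; the commutation makes such solutions multiply like powers. -/
structure IsPowerAlong (b b' : ℝ → 𝓐) (q : ℝ) (y : ℝ → 𝓐) : Prop where
  hasDerivAt : ∀ τ, HasDerivAt y (q • (b' τ * res (b τ) 0 * y τ)) τ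
  commute : ∀ τ x, Commute x (b τ) → Commute x (y τ)

lemma IsPowerAlong.mul {b b' : ℝ → 𝓐} {p q : ℝ} {y z : ℝ → 𝓐}
    (hb : ∀ τ, Commute (b' τ) (b τ)) (hy : IsPowerAlong b b' p y) (hz : IsPowerAlong b b' q z) :
    IsPowerAlong b b' (p + q) (fun τ => y τ * z τ) where
  hasDerivAt τ := by
    refine ((hy.hasDerivAt τ).mul (hz.hasDerivAt τ)).congr_deriv ?_
    have h1 : Commute (y τ) (b' τ * res (b τ) 0) :=
      (hy.commute τ _ ((hb τ).mul_left (commute_res (b τ) 0).symm)).symm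
    rw [smul_mul_assoc, mul_smul_comm, ← mul_assoc (y τ), h1.eq, add_smul]
    simp only [mul_assoc]
  commute τ x hx := (hy.commute τ x hx).mul_right (hz.commute τ x hx)

lemma IsPositivePath.isPowerAlong_self {b b' : ℝ → 𝓐} {K c : ℝ}
    (h : IsPositivePath b b' K c) : IsPowerAlong b b' 1 b where
  hasDerivAt τ := by
    have hinv : res (b τ) 0 * b τ = 1 := by simpa using res_mul_self (h.isUnit τ 0 le_rfl)
    rw [one_smul, mul_assoc, hinv, mul_one]
    exact h.hasDerivAt τ
  commute _ _ hx := hx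

lemma IsPositivePath.isPowerAlong_pow {b b' : ℝ → 𝓐} {K c : ℝ}
    (h : IsPositivePath b b' K c) (n : ℕ) :
    IsPowerAlong b b' n (fun τ => b τ ^ n) := by
  induction n with
  | zero =>
    refine ⟨fun τ => ?_, fun τ x _ => ?_⟩
    · simpa using hasDerivAt_const τ (1 : 𝓐)
    · simp
  | succ n ih =>
    have := ih.mul h.commute h.isPowerAlong_self
    simpa only [pow_succ, Nat.cast_succ] using this

lemma commute_balakrishnanPow {x a : 𝓐} {t : ℝ} (h : Commute x a)
    (hi : IntegrableOn (fun s : ℝ => s ^ (t - 1) • (res a s * a)) (Set.Ioi 0)) :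
    Commute x (balakrishnanPow a t) := by
  refine Commute.smul_right ?_ _
  rw [Commute, SemiconjBy, ← integral_const_mul_of_integrable hi,
    ← integral_mul_const_of_integrable hi]
  congr 1 with s
  rw [mul_smul_comm, smul_mul_assoc, ((h.res s).mul_right h).eq]

/-- Uniqueness for the linear equation `y' = q b' b⁻¹ y`. -/
lemma IsPositivePath.eq_of_isPowerAlong {b b' : ℝ → 𝓐} {K c : ℝ}
    (h : IsPositivePath b b' K c) {q : ℝ} {y z : ℝ → 𝓐}
    (hy : IsPowerAlong b b' q y) (hz : IsPowerAlong b b' q z) (h0 : y 0 = z 0) : y 1 = z 1 := by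
  obtain ⟨D, hD⟩ := isCompact_Icc.exists_bound_of_continuousOn
    (h.continuous_deriv.continuousOn (s := Set.Icc (0 : ℝ) 1))
  have hD0 : 0 ≤ D := (norm_nonneg _).trans (hD 0 (by simp))
  have hK := h.const_nonneg
  have hc := h.pos
  have hlip : ∀ τ ∈ Set.Ico (0 : ℝ) 1, LipschitzOnWith (Real.toNNReal (|q| * (D * (K / c))))
      (fun y => q • (b' τ * res (b τ) 0 * y)) (Set.univ : Set 𝓐) := by
    intro τ hτ
    refine LipschitzWith.lipschitzOnWith ?_
    refine LipschitzWith.of_dist_le_mul fun (y z : 𝓐) => ?_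
    rw [Real.coe_toNNReal _ (by positivity), dist_eq_norm, dist_eq_norm, ← smul_sub, ← mul_sub,
      norm_smul, Real.norm_eq_abs, mul_assoc |q|]
    refine mul_le_mul_of_nonneg_left ((norm_mul_le (b' τ * res (b τ) 0) (y - z)).trans ?_) (abs_nonneg q)
    refine mul_le_mul_of_nonneg_right ((norm_mul_le (b' τ) (res (b τ) 0)).trans ?_) (norm_nonneg _)
    exact mul_le_mul (hD τ ⟨hτ.1, hτ.2.le⟩) (h.norm_res_le_left τ le_rfl) (norm_nonneg _) hD0
  exact ODE_solution_unique_of_mem_Icc_right (v := fun τ y => q • (b' τ * res (b τ) 0 * y))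
    (s := fun _ => Set.univ) hlip
    (fun τ _ => (hy.hasDerivAt τ).continuousAt.continuousWithinAt)
    (fun τ _ => (hy.hasDerivAt τ).hasDerivWithinAt) (fun _ _ => trivial)
    (fun τ _ => (hz.hasDerivAt τ).continuousAt.continuousWithinAt)
    (fun τ _ => (hz.hasDerivAt τ).hasDerivWithinAt) (fun _ _ => trivial) h0
    (Set.right_mem_Icc.2 zero_le_one)

section

variable [CompleteSpace 𝓐]

/-- For `a = 1` the Balakrishnan integral is the scalar Beta integral. -/
lemma balakrishnanPow_one {t : ℝ} (ht : 0 < t) (ht' : t < 1) :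
    balakrishnanPow (1 : 𝓐) t = 1 := by
  have h : ∀ s ∈ Set.Ioi (0 : ℝ), s ^ (t - 1) • (res (1 : 𝓐) s * 1) =
      (s ^ (t - 1) / (1 + s)) • (1 : 𝓐) := by
    intro s hs
    have hs : 0 < s := hs
    have h1 : (1 : ℝ) + s ≠ 0 := by linarith
    have : res (1 : 𝓐) s = (1 + s)⁻¹ • (1 : 𝓐) := by
      have hu : ((1 + s) • (1 : 𝓐)) * ((1 + s)⁻¹ • (1 : 𝓐)) = 1 := by
        rw [smul_mul_smul_comm, mul_one, mul_inv_cancel₀ h1, one_smul]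
      have hu' : ((1 + s)⁻¹ • (1 : 𝓐)) * ((1 + s) • (1 : 𝓐)) = 1 := by
        rw [smul_mul_smul_comm, mul_one, inv_mul_cancel₀ h1, one_smul]
      have e : (1 : 𝓐) + s • (1 : 𝓐) = (1 + s) • (1 : 𝓐) := by rw [add_smul, one_smul]
      rw [res, e]
      exact Ring.inverse_unit ⟨_, _, hu, hu'⟩
    rw [this, mul_one, smul_smul, div_eq_mul_inv]
  rw [balakrishnanPow, setIntegral_congr_fun measurableSet_Ioi h, integral_smul_const,
    integral_Ioi_rpow_div_one_add ht ht', smul_smul]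
  have hsin : Real.sin (Real.pi * t) ≠ 0 := by
    refine (Real.sin_pos_of_pos_of_lt_pi (by positivity) ?_).ne'
    nlinarith [Real.pi_pos]
  rw [div_mul_div_comm, mul_comm Real.pi (Real.sin _), div_self (mul_ne_zero hsin Real.pi_ne_zero), one_smul]

lemma realPow_one (q : ℝ) : realPow (1 : 𝓐) q = 1 := by
  unfold realPow
  split_ifs with h
  · exact one_pow _
  · rw [one_pow, mul_one, balakrishnanPow_one
      ((Int.fract_nonneg q).lt_of_ne' h) (Int.fract_lt_one q)]

namespace IsPositivePath

variable {b b' : ℝ → 𝓐} {K c : ℝ}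

lemma isPowerAlong_balakrishnanPow (h : IsPositivePath b b' K c) {t : ℝ} (ht : 0 < t)
    (ht' : t < 1) : IsPowerAlong b b' t (fun τ => balakrishnanPow (b τ) t) where
  hasDerivAt τ := h.hasDerivAt_balakrishnanPow τ ht ht'
  commute τ x hx := by
    refine commute_balakrishnanPow hx ?_
    have := (h.integrableOn_res τ ht ht').mul_const (b τ)
    simp only [smul_mul_assoc] at this
    exact this

lemma isPowerAlong_realPow (h : IsPositivePath b b' K c) {q : ℝ} (hq : 0 ≤ q) :
    IsPowerAlong b b' q (fun τ => realPow (b τ) q) := by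
  have hfl : ((⌊q⌋₊ : ℕ) : ℝ) = ⌊q⌋ := natCast_floor_eq_intCast_floor hq
  unfold realPow
  split_ifs with hf
  · have := h.isPowerAlong_pow ⌊q⌋₊
    rwa [hfl, ← sub_eq_zero.1 hf] at this
  · have := (h.isPowerAlong_balakrishnanPow ((Int.fract_nonneg q).lt_of_ne' hf)
      (Int.fract_lt_one q)).mul h.commute (h.isPowerAlong_pow ⌊q⌋₊)
    rwa [hfl, Int.fract_add_floor] at this

/-- The exponent law at the end point of a positive path that starts at `1`: both sides solve the
same linear equation along the path. -/
lemma realPow_add (h : IsPositivePath b b' K c) (h0 : b 0 = 1) {p q : ℝ} (hp : 0 ≤ p)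
    (hq : 0 ≤ q) : realPow (b 1) (p + q) = realPow (b 1) p * realPow (b 1) q := by
  refine h.eq_of_isPowerAlong (h.isPowerAlong_realPow (add_nonneg hp hq))
    ((h.isPowerAlong_realPow hp).mul h.commute (h.isPowerAlong_realPow hq)) ?_
  simp only [h0, realPow_one, mul_one]

end IsPositivePath

end

/-- `a` is of positive type with constant `κ`, in the sense of Banach algebras. -/
def IsPositiveTypeWith (κ : ℝ) (a : 𝓐) : Prop :=
  ∀ s : ℝ, 0 < s → IsUnit (a + s • (1 : 𝓐)) ∧ ‖res a s‖ ≤ κ / s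

namespace IsPositiveTypeWith

variable {κ : ℝ} {a : 𝓐}

lemma const_nonneg (h : IsPositiveTypeWith κ a) : 0 ≤ κ := by
  simpa using (norm_nonneg _).trans (h 1 one_pos).2

lemma isUnit_and_norm_inverse_le (h : IsPositiveTypeWith κ a) {x y : ℝ} (hx : 0 ≤ x)
    (hy : 0 < y) : IsUnit (x • a + y • (1 : 𝓐)) ∧
      ‖Ring.inverse (x • a + y • (1 : 𝓐))‖ ≤ (κ + ‖(1 : 𝓐)‖) / y := by
  have hκ := h.const_nonneg
  rcases hx.eq_or_lt with rfl | hx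
  · have hu : (y • (1 : 𝓐)) * (y⁻¹ • (1 : 𝓐)) = 1 := by
      rw [smul_mul_smul_comm, mul_one, mul_inv_cancel₀ hy.ne', one_smul]
    have hu' : (y⁻¹ • (1 : 𝓐)) * (y • (1 : 𝓐)) = 1 := by
      rw [smul_mul_smul_comm, mul_one, inv_mul_cancel₀ hy.ne', one_smul]
    have e : Ring.inverse (y • (1 : 𝓐)) = y⁻¹ • (1 : 𝓐) := Ring.inverse_unit ⟨_, _, hu, hu'⟩
    rw [zero_smul, zero_add, e]
    refine ⟨⟨⟨_, _, hu, hu'⟩, rfl⟩, ?_⟩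
    rw [norm_smul, norm_inv, Real.norm_of_nonneg hy.le, inv_mul_eq_div]
    gcongr
    linarith
  · obtain ⟨hu, hn⟩ := h (y / x) (by positivity)
    have e : x • a + y • (1 : 𝓐) = x • (a + (y / x) • (1 : 𝓐)) := by
      rw [smul_add, smul_smul, mul_div_cancel₀ _ hx.ne']
    have h1 : (x • (a + (y / x) • (1 : 𝓐))) * (x⁻¹ • res a (y / x)) = 1 := by
      rw [smul_mul_smul_comm, mul_inv_cancel₀ hx.ne', one_smul]
      exact Ring.mul_inverse_cancel _ hu
    have h2 : (x⁻¹ • res a (y / x)) * (x • (a + (y / x) • (1 : 𝓐))) = 1 := by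
      rw [smul_mul_smul_comm, inv_mul_cancel₀ hx.ne', one_smul]
      exact Ring.inverse_mul_cancel _ hu
    have e2 : Ring.inverse (x • (a + (y / x) • (1 : 𝓐))) = x⁻¹ • res a (y / x) :=
      Ring.inverse_unit ⟨_, _, h1, h2⟩
    rw [e, e2]
    refine ⟨⟨⟨_, _, h1, h2⟩, rfl⟩, ?_⟩
    rw [norm_smul, norm_inv, Real.norm_of_nonneg hx.le]
    calc x⁻¹ * ‖res a (y / x)‖ ≤ x⁻¹ * (κ / (y / x)) := by gcongr
      _ = κ / y := by field_simp
      _ ≤ (κ + ‖(1 : 𝓐)‖) / y := by gcongr; linarith [norm_nonneg (1 : 𝓐)]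

/-- The path `(1 - τ)² + τ² (a + ε)` joins `1` to `a + ε`. Quadratic coefficients keep it of
positive type for all real `τ`, so that no one-sided derivatives appear. -/
lemma isPositivePath (h : IsPositiveTypeWith κ a) {ε : ℝ} (hε : 0 < ε) :
    IsPositivePath (fun τ : ℝ => (1 - τ) ^ 2 • (1 : 𝓐) + τ ^ 2 • (a + ε • (1 : 𝓐)))
      (fun τ => (-2 * (1 - τ)) • (1 : 𝓐) + (2 * τ) • (a + ε • (1 : 𝓐)))
      (κ + ‖(1 : 𝓐)‖) (ε / (1 + ε)) := by
  have hκ := h.const_nonneg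
  have hlow : ∀ τ : ℝ, ε / (1 + ε) ≤ (1 - τ) ^ 2 + τ ^ 2 * ε := by
    intro τ
    rw [div_le_iff₀ (by positivity)]
    -- the minimum is attained at `τ = 1 / (1 + ε)`
    nlinarith [sq_nonneg ((1 + ε) * τ - 1)]
  have hkey : ∀ τ s : ℝ, 0 ≤ s →
      IsUnit ((1 - τ) ^ 2 • (1 : 𝓐) + τ ^ 2 • (a + ε • (1 : 𝓐)) + s • (1 : 𝓐)) ∧
      ‖Ring.inverse ((1 - τ) ^ 2 • (1 : 𝓐) + τ ^ 2 • (a + ε • (1 : 𝓐)) + s • (1 : 𝓐))‖ ≤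
        (κ + ‖(1 : 𝓐)‖) / (ε / (1 + ε) + s) := by
    intro τ s hs
    have hpos : 0 < ε / (1 + ε) + s := by positivity
    have hl := hlow τ
    have e : (1 - τ) ^ 2 • (1 : 𝓐) + τ ^ 2 • (a + ε • (1 : 𝓐)) + s • (1 : 𝓐) =
        τ ^ 2 • a + ((1 - τ) ^ 2 + τ ^ 2 * ε + s) • (1 : 𝓐) := by
      simp only [smul_add, add_smul, mul_smul]; abel
    obtain ⟨h1, h2⟩ := h.isUnit_and_norm_inverse_le (sq_nonneg τ)
      (show 0 < (1 - τ) ^ 2 + τ ^ 2 * ε + s by linarith)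
    rw [e]
    refine ⟨h1, h2.trans ?_⟩
    gcongr
  refine ⟨fun τ => ?_, by fun_prop, fun τ => ?_, by positivity, fun τ s hs => (hkey τ s hs).1,
    fun τ s hs => (hkey τ s hs).2⟩
  · have h1 : HasDerivAt (fun τ : ℝ => (1 - τ) ^ 2) (-2 * (1 - τ)) τ := by
      have := ((hasDerivAt_id τ).const_sub 1).pow 2
      refine this.congr_deriv ?_
      simp
    have h2 : HasDerivAt (fun τ : ℝ => τ ^ 2) (2 * τ) τ := by
      simpa using hasDerivAt_pow 2 τ
    exact (h1.smul_const (1 : 𝓐)).add (h2.smul_const _)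
  · have h1 : ∀ (x : ℝ) (y : 𝓐), Commute (x • (1 : 𝓐)) y :=
      fun x y => (Commute.one_left y).smul_left x
    refine (h1 _ _).add_left (((h1 _ _).symm.add_right ?_))
    exact ((Commute.refl _).smul_left _).smul_right _

lemma realPow_shift_add [CompleteSpace 𝓐] (h : IsPositiveTypeWith κ a) {ε : ℝ} (hε : 0 < ε)
    {p q : ℝ} (hp : 0 ≤ p) (hq : 0 ≤ q) :
    realPow (a + ε • (1 : 𝓐)) (p + q) =
      realPow (a + ε • (1 : 𝓐)) p * realPow (a + ε • (1 : 𝓐)) q := by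
  have := (h.isPositivePath hε).realPow_add (by simp) hp hq
  simpa using this

end IsPositiveTypeWith

end Semigroup

/-! ### The moment inequality, the exponent law and spectral cut-offs -/

lemma norm_pow_mul_le_of_norm_le {R : Type*} [NormedRing R] {x : R} {M : ℝ} (hx : ‖x‖ ≤ M)
    (n : ℕ) (y : R) : ‖x ^ n * y‖ ≤ M ^ n * ‖y‖ := by
  have hM : 0 ≤ M := (norm_nonneg _).trans hx
  induction n with
  | zero => simp
  | succ n ih =>
    rw [pow_succ', mul_assoc, pow_succ', mul_assoc]
    exact (norm_mul_le _ _).trans (mul_le_mul hx ih (norm_nonneg _) hM)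

lemma sin_pi_mul_div_pi_le {t : ℝ} (ht : 0 ≤ t) : Real.sin (Real.pi * t) / Real.pi ≤ t := by
  rw [div_le_iff₀ Real.pi_pos, mul_comm t]
  exact Real.sin_le (by positivity)

lemma sin_pi_mul_div_pi_le_one_sub {t : ℝ} (ht : t ≤ 1) :
    Real.sin (Real.pi * t) / Real.pi ≤ 1 - t := by
  have := sin_pi_mul_div_pi_le (sub_nonneg.2 ht)
  rwa [mul_sub, mul_one, Real.sin_pi_sub] at this

lemma sin_pi_mul_div_pi_nonneg {t : ℝ} (ht : 0 ≤ t) (ht' : t ≤ 1) :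
    0 ≤ Real.sin (Real.pi * t) / Real.pi :=
  div_nonneg (Real.sin_nonneg_of_nonneg_of_le_pi (by positivity)
    (by nlinarith [Real.pi_pos])) Real.pi_pos.le

namespace IsPositiveTypeWith

variable {𝓐 : Type*} [NormedRing 𝓐] [NormedAlgebra ℝ 𝓐] {κ : ℝ} {a : 𝓐}

lemma norm_res_mul_self_mul_le (h : IsPositiveTypeWith κ a) {s : ℝ} (hs : 0 < s) (x : 𝓐) :
    ‖res a s * a * x‖ ≤ (1 + κ) * ‖x‖ ∧ ‖res a s * a * x‖ ≤ κ * ‖a * x‖ / s := by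
  obtain ⟨hu, hn⟩ := h s hs
  constructor
  · rw [res_mul_self hu, sub_mul, one_mul, smul_mul_assoc, add_mul, one_mul]
    refine (norm_sub_le _ _).trans (add_le_add le_rfl ?_)
    rw [norm_smul, Real.norm_of_nonneg hs.le]
    calc s * ‖res a s * x‖ ≤ s * (κ / s * ‖x‖) := by
          gcongr
          exact (norm_mul_le _ _).trans (by gcongr)
      _ = κ * ‖x‖ := by field_simp
  · rw [mul_assoc]
    calc ‖res a s * (a * x)‖ ≤ κ / s * ‖a * x‖ := (norm_mul_le _ _).trans (by gcongr)
      _ = κ * ‖a * x‖ / s := by ring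

lemma shift (h : IsPositiveTypeWith κ a) {ε : ℝ} (hε : 0 ≤ ε) :
    IsPositiveTypeWith κ (a + ε • (1 : 𝓐)) := by
  intro s hs
  have e : a + ε • (1 : 𝓐) + s • (1 : 𝓐) = a + (ε + s) • (1 : 𝓐) := by rw [add_smul, add_assoc]
  obtain ⟨hu, hn⟩ := h (ε + s) (by positivity)
  rw [res, e]
  refine ⟨hu, hn.trans ?_⟩
  have := h.const_nonneg
  gcongr
  linarith

variable [CompleteSpace 𝓐]

lemma continuousOn_res (h : IsPositiveTypeWith κ a) : ContinuousOn (res a) (Set.Ioi 0) :=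
  _root_.continuousOn_res fun s hs => (h s hs).1

lemma integrableOn_balakrishnan (h : IsPositiveTypeWith κ a) {t : ℝ} (ht : 0 < t) (ht' : t < 1)
    (x : 𝓐) :
    IntegrableOn (fun s : ℝ => s ^ (t - 1) • (res a s * a * x)) (Set.Ioi 0) ∧
      ∀ s, 0 < s → ‖s ^ (t - 1) • (res a s * a * x)‖ ≤
        kernelMajorant t ((1 + κ) * ‖x‖) (κ * ‖a * x‖) s :=
  integrableOn_rpow_smul_of_norm_le ht ht'
    ((h.continuousOn_res.mul continuousOn_const).mul continuousOn_const)
    (fun _ hs => (h.norm_res_mul_self_mul_le hs x).1)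
    (fun _ hs => (h.norm_res_mul_self_mul_le hs x).2)

lemma integrableOn_balakrishnan_one (h : IsPositiveTypeWith κ a) {t : ℝ} (ht : 0 < t)
    (ht' : t < 1) :
    IntegrableOn (fun s : ℝ => s ^ (t - 1) • (res a s * a)) (Set.Ioi 0) := by
  simpa only [mul_one] using (h.integrableOn_balakrishnan ht ht' 1).1

lemma kernelMajorant_mono {t P Q P' Q' s : ℝ} (hs : 0 < s) (hP : P ≤ P') (hQ : Q ≤ Q') :
    kernelMajorant t P Q s ≤ kernelMajorant t P' Q' s :=
  mul_le_mul_of_nonneg_left (min_le_min hP (by gcongr)) (Real.rpow_nonneg hs.le _)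

/-- The moment inequality: an element on which `a` acts with size at most `α` is multiplied by
at most a constant times `α ^ t` under `a ^ t`, uniformly in `t`. The factor `sin (π t) / π`
compensates the poles of the majorant integral at `t = 0` and `t = 1`. -/
lemma norm_balakrishnanPow_mul_le (h : IsPositiveTypeWith κ a) {t : ℝ} (ht : 0 < t)
    (ht' : t < 1) {x : 𝓐} {N α : ℝ} (hα : 0 < α) (hx : ‖x‖ ≤ N) (hax : ‖a * x‖ ≤ N * α) :
    ‖balakrishnanPow a t * x‖ ≤ (1 + 2 * κ) * N * α ^ t := by
  have hκ := h.const_nonneg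
  have hN : 0 ≤ N := (norm_nonneg _).trans hx
  obtain ⟨hi, hb⟩ := h.integrableOn_balakrishnan ht ht' x
  have e : balakrishnanPow a t * x = (Real.sin (Real.pi * t) / Real.pi) •
      ∫ s in Set.Ioi (0 : ℝ), s ^ (t - 1) • (res a s * a * x) := by
    rw [balakrishnanPow, smul_mul_assoc,
      ← integral_mul_const_of_integrable (h.integrableOn_balakrishnan_one ht ht')]
    simp only [smul_mul_assoc]
  have hP : 0 ≤ (1 + κ) * N := by positivity
  have hQ : 0 ≤ κ * N := by positivity
  have hint : ‖∫ s in Set.Ioi (0 : ℝ), s ^ (t - 1) • (res a s * a * x)‖ ≤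
      α ^ t * ((1 + κ) * N / t + κ * N / (1 - t)) := by
    refine le_trans ?_ (integral_kernelMajorant_le ht ht' hP hQ hα)
    refine norm_integral_le_of_norm_le
      (integrableOn_kernelMajorant ht ht' hP (mul_nonneg hQ hα.le)) ?_
    refine ae_restrict_of_forall_mem measurableSet_Ioi fun s hs => (hb s hs).trans ?_
    refine kernelMajorant_mono hs (by gcongr) ?_
    rw [mul_assoc]
    gcongr
  have hs0 := sin_pi_mul_div_pi_nonneg ht.le ht'.le
  have ht1 : 0 < 1 - t := by linarith
  have hαt : 0 ≤ α ^ t := Real.rpow_nonneg hα.le _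
  rw [e, norm_smul, Real.norm_of_nonneg hs0]
  calc Real.sin (Real.pi * t) / Real.pi *
        ‖∫ s in Set.Ioi (0 : ℝ), s ^ (t - 1) • (res a s * a * x)‖
      ≤ Real.sin (Real.pi * t) / Real.pi * (α ^ t * ((1 + κ) * N / t + κ * N / (1 - t))) := by
        gcongr
    _ = α ^ t * (Real.sin (Real.pi * t) / Real.pi * ((1 + κ) * N / t) +
          Real.sin (Real.pi * t) / Real.pi * (κ * N / (1 - t))) := by ring
    _ ≤ α ^ t * (t * ((1 + κ) * N / t) + (1 - t) * (κ * N / (1 - t))) := by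
        gcongr
        · exact sin_pi_mul_div_pi_le ht.le
        · exact sin_pi_mul_div_pi_le_one_sub ht'.le
    _ = (1 + 2 * κ) * N * α ^ t := by field_simp; ring

/-- The moment inequality for all exponents `q ≥ 0`. -/
lemma norm_realPow_mul_le (h : IsPositiveTypeWith κ a) {q : ℝ} (hq : 0 ≤ q)
    {x : 𝓐} {N α : ℝ} (hα : 0 < α) (h0 : ‖a ^ ⌊q⌋₊ * x‖ ≤ N * α ^ ⌊q⌋₊)
    (h1 : ‖a ^ (⌊q⌋₊ + 1) * x‖ ≤ N * α ^ (⌊q⌋₊ + 1)) :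
    ‖realPow a q * x‖ ≤ (1 + 2 * κ) * N * α ^ q := by
  have hκ := h.const_nonneg
  have hfl : ((⌊q⌋₊ : ℕ) : ℝ) = ⌊q⌋ := natCast_floor_eq_intCast_floor hq
  have hN : 0 ≤ N := by
    have := (norm_nonneg _).trans h0
    exact nonneg_of_mul_nonneg_left this (by positivity)
  have hpow : α ^ q = α ^ ⌊q⌋₊ * α ^ Int.fract q := by
    rw [← Real.rpow_natCast, ← Real.rpow_add hα, hfl, Int.floor_add_fract]
  unfold realPow
  split_ifs with hf
  · rw [hpow, hf, Real.rpow_zero, mul_one]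
    refine h0.trans ?_
    have : 0 ≤ κ * (N * α ^ ⌊q⌋₊) := by positivity
    nlinarith
  · rw [hpow, mul_assoc]
    refine (h.norm_balakrishnanPow_mul_le ((Int.fract_nonneg q).lt_of_ne' hf)
      (Int.fract_lt_one q) hα h0 ?_).trans_eq (by ring)
    rw [← mul_assoc, ← pow_succ', mul_assoc N, ← pow_succ]
    exact h1

lemma norm_realPow_le (h : IsPositiveTypeWith κ a) {ω : ℝ} (hω : ‖a‖ ≤ Real.exp ω) {q : ℝ}
    (hq : 0 ≤ q) : ‖realPow a q‖ ≤ (1 + 2 * κ) * ‖(1 : 𝓐)‖ * Real.exp (ω * q) := by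
  have hb := fun n => norm_pow_mul_le_of_norm_le hω n (1 : 𝓐)
  have := h.norm_realPow_mul_le hq (Real.exp_pos ω) (x := 1) (N := ‖(1 : 𝓐)‖)
    ((hb _).trans_eq (mul_comm _ _)) ((hb _).trans_eq (mul_comm _ _))
  rwa [mul_one, ← Real.exp_mul] at this

lemma tendsto_balakrishnanPow_shift (h : IsPositiveTypeWith κ a) {t : ℝ} (ht : 0 < t)
    (ht' : t < 1) :
    Tendsto (fun ε : ℝ => balakrishnanPow (a + ε • (1 : 𝓐)) t) (𝓝[>] 0)
      (𝓝 (balakrishnanPow a t)) := by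
  have hκ := h.const_nonneg
  refine Tendsto.const_smul ?_ _
  refine tendsto_integral_filter_of_dominated_convergence
    (kernelMajorant t ((1 + κ) * ‖(1 : 𝓐)‖) (κ * (‖a‖ + ‖(1 : 𝓐)‖))) ?_ ?_
    (integrableOn_kernelMajorant ht ht' (by positivity) (by positivity)) ?_
  · filter_upwards [self_mem_nhdsWithin] with ε hε
    exact ((h.shift (le_of_lt hε)).integrableOn_balakrishnan_one ht ht').aestronglyMeasurable
  · have hmem : Set.Ioo (0 : ℝ) 1 ∈ 𝓝[>] (0 : ℝ) := Ioo_mem_nhdsGT one_pos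
    filter_upwards [hmem] with ε hε
    refine ae_restrict_of_forall_mem measurableSet_Ioi fun s hs => ?_
    have := ((h.shift hε.1.le).integrableOn_balakrishnan ht ht' 1).2 s hs
    simp only [mul_one] at this
    refine this.trans (kernelMajorant_mono hs le_rfl ?_)
    gcongr
    refine (norm_add_le _ _).trans ?_
    gcongr
    rw [norm_smul, Real.norm_of_nonneg hε.1.le]
    exact mul_le_of_le_one_left (norm_nonneg _) hε.2.le
  · refine ae_restrict_of_forall_mem measurableSet_Ioi fun s hs => ?_
    refine Tendsto.const_smul ?_ _
    have hsh : Tendsto (fun ε : ℝ => a + ε • (1 : 𝓐)) (𝓝[>] 0) (𝓝 a) := by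
      have : Continuous fun ε : ℝ => a + ε • (1 : 𝓐) := by fun_prop
      simpa using (this.tendsto 0).mono_left nhdsWithin_le_nhds
    refine Tendsto.mul ?_ hsh
    obtain ⟨u, hu⟩ := (h s hs).1
    have hc := NormedRing.inverse_continuousAt u
    rw [hu] at hc
    exact hc.tendsto.comp (hsh.add_const _)

lemma tendsto_realPow_shift (h : IsPositiveTypeWith κ a) (q : ℝ) :
    Tendsto (fun ε : ℝ => realPow (a + ε • (1 : 𝓐)) q) (𝓝[>] 0) (𝓝 (realPow a q)) := by
  have hpow : Tendsto (fun ε : ℝ => (a + ε • (1 : 𝓐)) ^ ⌊q⌋₊) (𝓝[>] 0) (𝓝 (a ^ ⌊q⌋₊)) := by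
    have : Continuous fun ε : ℝ => (a + ε • (1 : 𝓐)) ^ ⌊q⌋₊ := by fun_prop
    simpa using (this.tendsto 0).mono_left nhdsWithin_le_nhds
  unfold realPow
  split_ifs with hf
  · exact hpow
  · exact (h.tendsto_balakrishnanPow_shift ((Int.fract_nonneg q).lt_of_ne' hf)
      (Int.fract_lt_one q)).mul hpow

/-- The exponent law, by passing to the limit `ε ↓ 0` in the invertible elements `a + ε`. -/
lemma realPow_add (h : IsPositiveTypeWith κ a) {p q : ℝ} (hp : 0 ≤ p) (hq : 0 ≤ q) :
    realPow a (p + q) = realPow a p * realPow a q := by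
  refine tendsto_nhds_unique (h.tendsto_realPow_shift (p + q)) ?_
  refine ((h.tendsto_realPow_shift p).mul (h.tendsto_realPow_shift q)).congr' ?_
  filter_upwards [self_mem_nhdsWithin] with ε hε
  exact (h.realPow_shift_add hε hp hq).symm

lemma commute_realPow (h : IsPositiveTypeWith κ a) {x : 𝓐} (hx : Commute x a) (q : ℝ) :
    Commute x (realPow a q) := by
  unfold realPow
  split_ifs with hf
  · exact hx.pow_right _
  · exact (commute_balakrishnanPow hx (h.integrableOn_balakrishnan_one
      ((Int.fract_nonneg q).lt_of_ne' hf) (Int.fract_lt_one q))).mul_right (hx.pow_right _)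

end IsPositiveTypeWith

section Cutoff

variable {𝓐 : Type*} [NormedRing 𝓐] [NormedAlgebra ℝ 𝓐] {κ : ℝ} {a : 𝓐}

/-- The spectral cut-off `(α (a + α)⁻¹) ^ m`, concentrated on the part of the spectrum of size at
most `α`. -/
noncomputable def cutoff (a : 𝓐) (m : ℕ) (α : ℝ) : 𝓐 := (α • res a α) ^ m

lemma commute_cutoff (a : 𝓐) (m : ℕ) (α : ℝ) : Commute a (cutoff a m α) :=
  ((commute_res a α).smul_right α).pow_right m

namespace IsPositiveTypeWith

lemma norm_smul_res_le (h : IsPositiveTypeWith κ a) {α : ℝ} (hα : 0 < α) :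
    ‖α • res a α‖ ≤ κ := by
  rw [norm_smul, Real.norm_of_nonneg hα.le]
  calc α * ‖res a α‖ ≤ α * (κ / α) := by gcongr; exact (h α hα).2
    _ = κ := by field_simp

lemma norm_pow_mul_cutoff_le (h : IsPositiveTypeWith κ a) {α : ℝ} (hα : 0 < α) {k m : ℕ}
    (hk : k ≤ m) :
    ‖a ^ k * cutoff a m α‖ ≤ (‖(1 : 𝓐)‖ + κ + 1) ^ m * ‖(1 : 𝓐)‖ * α ^ k := by
  have hκ := h.const_nonneg
  set M := ‖(1 : 𝓐)‖ + κ + 1 with hM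
  have h1 : ‖res a α * a‖ ≤ M := by
    rw [res_mul_self (h α hα).1]
    refine (norm_sub_le _ _).trans ?_
    linarith [h.norm_smul_res_le hα]
  have h2 : ‖α • res a α‖ ≤ M := by
    linarith [h.norm_smul_res_le hα, norm_nonneg (1 : 𝓐)]
  have e : a ^ k * cutoff a m α =
      α ^ k • ((res a α * a) ^ k * ((α • res a α) ^ (m - k) * 1)) := by
    obtain ⟨j, rfl⟩ := Nat.exists_eq_add_of_le hk
    rw [cutoff, pow_add, ← mul_assoc, Nat.add_sub_cancel_left, mul_one, ← smul_mul_assoc,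
      ← (((commute_res a α).smul_right α)).mul_pow, ← smul_pow, (commute_res a α).eq.symm,
      mul_smul_comm]
  rw [e, norm_smul, Real.norm_of_nonneg (by positivity), mul_comm]
  gcongr
  calc ‖(res a α * a) ^ k * ((α • res a α) ^ (m - k) * 1)‖
      ≤ M ^ k * (M ^ (m - k) * ‖(1 : 𝓐)‖) :=
        (norm_pow_mul_le_of_norm_le h1 _ _).trans
          (by gcongr; exact norm_pow_mul_le_of_norm_le h2 _ _)
    _ = M ^ m * ‖(1 : 𝓐)‖ := by rw [← mul_assoc, ← pow_add, Nat.add_sub_cancel' hk]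

/-- On the range of the cut-off at level `α`, the power `a ^ q` has size `α ^ q`. -/
lemma norm_realPow_mul_cutoff_le [CompleteSpace 𝓐] (h : IsPositiveTypeWith κ a) {α : ℝ}
    (hα : 0 < α) {m : ℕ} {q : ℝ} (hq : 0 ≤ q) (hqm : q < m) :
    ‖realPow a q * cutoff a m α‖ ≤
      (1 + 2 * κ) * ((‖(1 : 𝓐)‖ + κ + 1) ^ m * ‖(1 : 𝓐)‖) * α ^ q := by
  have hfl : ⌊q⌋₊ < m := (Nat.floor_lt hq).2 hqm
  exact h.norm_realPow_mul_le hq hα (h.norm_pow_mul_cutoff_le hα hfl.le)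
    (h.norm_pow_mul_cutoff_le hα hfl)

/-- The complement of the cut-off is divisible by `a`, with a quotient of size `1 / α`. -/
lemma exists_one_sub_cutoff_eq (h : IsPositiveTypeWith κ a) (m : ℕ) {α : ℝ} (hα : 0 < α) :
    ∃ y : 𝓐, 1 - cutoff a m α = y * a ∧
      ‖y‖ ≤ m * ((‖(1 : 𝓐)‖ + κ + 1) ^ m * κ) / α := by
  have hκ := h.const_nonneg
  set M := ‖(1 : 𝓐)‖ + κ + 1 with hM
  have hM1 : 1 ≤ M := by linarith [norm_nonneg (1 : 𝓐)]
  refine ⟨∑ i ∈ Finset.range m, (α • res a α) ^ i * res a α, ?_, ?_⟩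
  · have e : res a α * a = -(α • res a α - 1) := by rw [res_mul_self (h α hα).1]; abel
    rw [← Finset.sum_mul, mul_assoc, e, mul_neg, geom_sum_mul, neg_sub, cutoff]
  · refine (norm_sum_le _ _).trans ?_
    have : ∀ i ∈ Finset.range m, ‖(α • res a α) ^ i * res a α‖ ≤ M ^ m * κ / α := by
      intro i hi
      have hi : i ≤ m := (Finset.mem_range.1 hi).le
      refine (norm_pow_mul_le_of_norm_le (M := M) ?_ _ _).trans ?_
      · linarith [h.norm_smul_res_le hα, norm_nonneg (1 : 𝓐)]
      · rw [mul_div_assoc]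
        exact mul_le_mul (pow_le_pow_right₀ hM1 hi) (h α hα).2 (norm_nonneg _) (by positivity)
    refine (Finset.sum_le_card_nsmul _ _ _ this).trans_eq ?_
    rw [Finset.card_range, nsmul_eq_mul]
    ring

end IsPositiveTypeWith

end Cutoff

/-! ### Orbits of semigroups and the inverse of `lam - log A` -/

section OperatorSemigroup

variable {E : Type*} [NormedAddCommGroup E] [NormedSpace ℝ E]

/-- A one-parameter semigroup of bounded operators with exponential growth; no continuity in the
parameter is required. -/
structure IsBoundedSemigroup (S : ℝ → E →L[ℝ] E) (C ω : ℝ) : Prop where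
  zero : S 0 = 1
  add : ∀ s t, 0 ≤ s → 0 ≤ t → S (s + t) = S s * S t
  norm_le : ∀ t, 0 ≤ t → ‖S t‖ ≤ C * Real.exp (ω * t)

namespace IsBoundedSemigroup

variable {S : ℝ → E →L[ℝ] E} {C ω : ℝ}

lemma const_nonneg (h : IsBoundedSemigroup S C ω) : 0 ≤ C := by
  simpa using (norm_nonneg _).trans (h.norm_le 0 le_rfl)

/-- Strong continuity at `0` on the vectors where the difference quotient converges. -/
lemma tendsto_of_tendsto_quotient {v y : E} (h : IsBoundedSemigroup S C ω)
    (hy : Tendsto (fun q : ℝ => q⁻¹ • (S q v - v)) (𝓝[>] 0) (𝓝 y)) :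
    Tendsto (fun x : ℝ => S |x| v) (𝓝 0) (𝓝 v) := by
  have h1 : Tendsto (fun q : ℝ => q) (𝓝[>] 0) (𝓝 0) := nhdsWithin_le_nhds
  have h2 : Tendsto (fun q : ℝ => S q v) (𝓝[>] 0) (𝓝 v) := by
    have := (h1.smul hy).add_const v
    rw [zero_smul, zero_add] at this
    refine this.congr' ?_
    filter_upwards [self_mem_nhdsWithin] with q hq
    rw [smul_inv_smul₀ (ne_of_gt hq), sub_add_cancel]
  have hS0 : S 0 v = v := by rw [h.zero]; rfl
  have h3 : ContinuousWithinAt (fun q : ℝ => S q v) (Set.Ici 0) 0 := by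
    rw [← continuousWithinAt_Ioi_iff_Ici, ContinuousWithinAt, hS0]
    exact h2
  rw [ContinuousWithinAt, hS0] at h3
  refine h3.comp (tendsto_nhdsWithin_iff.2 ⟨?_, Eventually.of_forall fun x => abs_nonneg x⟩)
  simpa using (continuous_abs.tendsto (0 : ℝ))

lemma continuousOn {v y : E} (h : IsBoundedSemigroup S C ω)
    (hy : Tendsto (fun q : ℝ => q⁻¹ • (S q v - v)) (𝓝[>] 0) (𝓝 y)) :
    ContinuousOn (fun t => S t v) (Set.Ici 0) := by
  intro t₀ ht₀
  have ht₀ : 0 ≤ t₀ := ht₀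
  have hC := h.const_nonneg
  have hbound : ∀ s t : ℝ, 0 ≤ s → s ≤ t → s ≤ t₀ + 1 →
      ‖S t v - S s v‖ ≤ C * Real.exp (|ω| * (t₀ + 1)) * ‖S |t - s| v - v‖ := by
    intro s t hs hst hs1
    have e : S t v - S s v = S s (S |t - s| v - v) := by
      rw [abs_of_nonneg (sub_nonneg.2 hst), map_sub]
      congr 1
      have := h.add s (t - s) hs (sub_nonneg.2 hst)
      rw [add_sub_cancel] at this
      rw [this]; rfl
    rw [e]
    refine ((S s).le_opNorm _).trans ?_
    gcongr
    refine (h.norm_le s hs).trans ?_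
    gcongr
    · exact le_abs_self ω
  have hlim : Tendsto (fun t => C * Real.exp (|ω| * (t₀ + 1)) * ‖S |t - t₀| v - v‖)
      (𝓝[Set.Ici 0] t₀) (𝓝 0) := by
    have h1 : Tendsto (fun t : ℝ => t - t₀) (𝓝[Set.Ici 0] t₀) (𝓝 0) := by
      have : Tendsto (fun t : ℝ => t - t₀) (𝓝 t₀) (𝓝 (t₀ - t₀)) :=
        (continuous_sub_right t₀).tendsto t₀
      rw [sub_self] at this
      exact this.mono_left nhdsWithin_le_nhds
    have h2 := (((h.tendsto_of_tendsto_quotient hy).comp h1).sub_const v).norm.const_mul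
      (C * Real.exp (|ω| * (t₀ + 1)))
    simpa using h2
  rw [ContinuousWithinAt, tendsto_iff_norm_sub_tendsto_zero]
  refine squeeze_zero' (Eventually.of_forall fun _ => norm_nonneg _) ?_ hlim
  filter_upwards [self_mem_nhdsWithin,
    mem_nhdsWithin_of_mem_nhds (Iio_mem_nhds (lt_add_one t₀))] with t ht ht1
  rcases le_total t₀ t with hle | hle
  · exact hbound t₀ t ht₀ hle (by linarith)
  · rw [norm_sub_rev, abs_sub_comm]
    exact hbound t t₀ ht hle (le_of_lt ht1)

lemma hasDerivWithinAt {v y : E} (h : IsBoundedSemigroup S C ω)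
    (hy : Tendsto (fun q : ℝ => q⁻¹ • (S q v - v)) (𝓝[>] 0) (𝓝 y)) {t : ℝ} (ht : 0 ≤ t) :
    HasDerivWithinAt (fun t => S t v) (S t y) (Set.Ici t) t := by
  rw [← hasDerivWithinAt_Ioi_iff_Ici, hasDerivWithinAt_iff_tendsto_slope' Set.self_notMem_Ioi]
  have h1 : Tendsto (fun x : ℝ => x - t) (𝓝[>] t) (𝓝[>] 0) := by
    refine tendsto_nhdsWithin_iff.2 ⟨?_, ?_⟩
    · have : Tendsto (fun x : ℝ => x - t) (𝓝 t) (𝓝 (t - t)) :=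
        (continuous_sub_right t).tendsto t
      rw [sub_self] at this
      exact this.mono_left nhdsWithin_le_nhds
    · filter_upwards [self_mem_nhdsWithin] with x hx
      exact sub_pos.2 (show t < x from hx)
  refine (((S t).continuous.tendsto y).comp (hy.comp h1)).congr' ?_
  filter_upwards [self_mem_nhdsWithin] with x hx
  have hx : t < x := hx
  have := h.add t (x - t) ht (sub_nonneg.2 hx.le)
  rw [add_sub_cancel] at this
  simp only [Function.comp, slope, vsub_eq_sub, map_smul, map_sub]
  rw [this]; rfl

/-- Inverting `lam - log A` once: along the rescaled orbit `e ^ (-lam t) S t`, the vector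
`lam v - y` is minus the derivative of `v`, where `y` is the generator applied to `v`, so that
decay estimates integrate from `t` to `∞`. -/
lemma norm_orbit_le_of_norm_orbit_sub_le {v y : E} (h : IsBoundedSemigroup S C ω)
    (hy : Tendsto (fun q : ℝ => q⁻¹ • (S q v - v)) (𝓝[>] 0) (𝓝 y)) (T : E →L[ℝ] E)
    {lam a b ℓ δ : ℝ} (hlam : ω < lam) (ha : 0 ≤ a) (hb : 0 ≤ b) (hℓ : 0 < ℓ) (hδ : 0 < δ)
    (hbd : ∀ t, 0 ≤ t → Real.exp (-lam * t) * ‖T (S t (lam • v - y))‖ ≤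
      a * Real.exp (-ℓ * t) + b * Real.exp (-δ * t)) {t : ℝ} (ht : 0 ≤ t) :
    Real.exp (-lam * t) * ‖T (S t v)‖ ≤
      a / ℓ * Real.exp (-ℓ * t) + b / δ * Real.exp (-δ * t) := by
  have hC := h.const_nonneg
  set g : ℝ → E := fun x => Real.exp (-lam * x) • T (S x v) with hg
  set g' : ℝ → E := fun x => -(Real.exp (-lam * x) • T (S x (lam • v - y))) with hg'
  have hexp : ∀ k x : ℝ, HasDerivAt (fun x => Real.exp (k * x)) (k * Real.exp (k * x)) x := by
    intro k x
    have := ((hasDerivAt_id x).const_mul k).exp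
    refine this.congr_deriv ?_
    simp; ring
  have hder : ∀ x, 0 ≤ x → HasDerivWithinAt g (g' x) (Set.Ici x) x := by
    intro x hx
    have h1 := (hexp (-lam) x).hasDerivWithinAt (s := Set.Ici x)
    have h2 := T.hasFDerivAt.comp_hasDerivWithinAt x (h.hasDerivWithinAt hy hx)
    refine (h1.smul h2).congr_deriv ?_
    simp only [hg', map_sub, map_smul, Function.comp]
    module
  have hcont : ContinuousOn g (Set.Ici 0) :=
    ContinuousOn.smul (by fun_prop) (T.continuous.comp_continuousOn (h.continuousOn hy))
  set B : ℝ → ℝ := fun x => a / ℓ * (Real.exp (-ℓ * t) - Real.exp (-ℓ * x)) +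
    b / δ * (Real.exp (-δ * t) - Real.exp (-δ * x)) with hB
  have hBder : ∀ x, HasDerivAt B (a * Real.exp (-ℓ * x) + b * Real.exp (-δ * x)) x := by
    intro x
    have := (((hexp (-ℓ) x).const_sub (Real.exp (-ℓ * t))).const_mul (a / ℓ)).add
      (((hexp (-δ) x).const_sub (Real.exp (-δ * t))).const_mul (b / δ))
    refine this.congr_deriv ?_
    field_simp
  have hmain : ∀ T', t ≤ T' → ‖g T' - g t‖ ≤ B T' := by
    intro T' hT'
    refine image_norm_le_of_norm_deriv_right_le_deriv_boundary (f := fun x => g x - g t)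
      (a := t) (b := T') (f' := g')
      ((hcont.mono fun x hx => ht.trans hx.1).sub continuousOn_const)
      (fun x hx => (hder x (ht.trans hx.1)).sub_const _) ?_ hBder ?_ ⟨hT', le_rfl⟩
    · simp [hB]
    · intro x hx
      rw [hg', norm_neg, norm_smul, Real.norm_of_nonneg (Real.exp_pos _).le]
      exact hbd x (ht.trans hx.1)
  have hle : ∀ T', t ≤ T' →
      ‖g t‖ ≤ a / ℓ * Real.exp (-ℓ * t) + b / δ * Real.exp (-δ * t) + ‖g T'‖ := by
    intro T' hT'
    have h1 := hmain T' hT'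
    have h2 : B T' ≤ a / ℓ * Real.exp (-ℓ * t) + b / δ * Real.exp (-δ * t) := by
      simp only [hB]
      gcongr
      · linarith [Real.exp_pos (-ℓ * T')]
      · linarith [Real.exp_pos (-δ * T')]
    have h3 : ‖g t‖ ≤ ‖g T' - g t‖ + ‖g T'‖ := by
      have := norm_sub_le (g T') (g T' - g t)
      rw [sub_sub_cancel] at this
      linarith
    linarith
  have hzero : Tendsto (fun x => ‖g x‖) atTop (𝓝 0) := by
    have h0 : Tendsto (fun x : ℝ => ‖T‖ * C * ‖v‖ * Real.exp (-((lam - ω) * x))) atTop (𝓝 0) := by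
      have : Tendsto (fun x : ℝ => Real.exp (-((lam - ω) * x))) atTop (𝓝 0) :=
        Real.tendsto_exp_neg_atTop_nhds_zero.comp
          (tendsto_id.const_mul_atTop (sub_pos.2 hlam))
      simpa using this.const_mul (‖T‖ * C * ‖v‖)
    refine squeeze_zero' (Eventually.of_forall fun _ => norm_nonneg _) ?_ h0
    filter_upwards [eventually_ge_atTop 0] with x hx
    simp only [hg]
    rw [norm_smul, Real.norm_of_nonneg (Real.exp_pos _).le]
    calc Real.exp (-lam * x) * ‖T (S x v)‖
        ≤ Real.exp (-lam * x) * (‖T‖ * (C * Real.exp (ω * x) * ‖v‖)) := by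
          gcongr
          refine (T.le_opNorm _).trans ?_
          gcongr
          refine ((S x).le_opNorm _).trans ?_
          gcongr
          exact h.norm_le x hx
      _ = ‖T‖ * C * ‖v‖ * (Real.exp (-lam * x) * Real.exp (ω * x)) := by ring
      _ = ‖T‖ * C * ‖v‖ * Real.exp (-((lam - ω) * x)) := by
          rw [← Real.exp_add]; ring_nf
  have hfin : ‖g t‖ ≤ a / ℓ * Real.exp (-ℓ * t) + b / δ * Real.exp (-δ * t) := by
    have := hzero.const_add (a / ℓ * Real.exp (-ℓ * t) + b / δ * Real.exp (-δ * t))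
    rw [add_zero] at this
    exact ge_of_tendsto this ((eventually_ge_atTop t).mono hle)
  simpa [hg, norm_smul, abs_of_pos (Real.exp_pos _)] using hfin

end IsBoundedSemigroup

end OperatorSemigroup

section Logarithm

variable {𝕜 X : Type*} [RCLike 𝕜] [NormedAddCommGroup X] [NormedSpace 𝕜 X] [NormedSpace ℝ X]
  {A : X →L[𝕜] X}

lemma logOp_eq_of_tendsto {u y : X} (h : Tendsto (logQuotient A u) (𝓝[>] 0) (𝓝 y)) :
    logOp A u = y := h.limUnder_eq

lemma tendsto_logQuotient {u : X} (h : u ∈ logDomain A) :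
    Tendsto (logQuotient A u) (𝓝[>] 0) (𝓝 (logOp A u)) := by
  obtain ⟨y, hy⟩ := h
  rwa [logOp_eq_of_tendsto hy]

lemma logPowDomain_succ_subset (n : ℕ) : logPowDomain A (n + 1) ⊆ logPowDomain A n := by
  induction n with
  | zero => exact fun _ _ => trivial
  | succ n ih => exact fun u hu => ⟨hu.1, ih hu.2⟩

variable {S : ℝ → X →L[ℝ] X}

lemma logQuotient_smul_sub (hS : ∀ q u, fracPow A q u = S q u) (c : ℝ) (u v : X) :
    logQuotient A (c • u - v) = fun q => c • logQuotient A u q - logQuotient A v q := by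
  ext q
  simp only [logQuotient, hS, map_sub, map_smul]
  module

lemma smul_sub_mem_logPowDomain (hS : ∀ q u, fracPow A q u = S q u) (c : ℝ) {n : ℕ} {u v : X}
    (hu : u ∈ logPowDomain A n) (hv : v ∈ logPowDomain A n) :
    c • u - v ∈ logPowDomain A n := by
  induction n generalizing u v with
  | zero => trivial
  | succ n ih =>
    have h : Tendsto (logQuotient A (c • u - v)) (𝓝[>] 0)
        (𝓝 (c • logOp A u - logOp A v)) := by
      rw [logQuotient_smul_sub hS]
      exact ((tendsto_logQuotient hu.1).const_smul c).sub (tendsto_logQuotient hv.1)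
    refine ⟨⟨_, h⟩, ?_⟩
    rw [logOp_eq_of_tendsto h]
    exact ih hu.2 hv.2

/-- Inverting `(lam - log A) ^ n`: each of the `n` integrations gains a factor `1 / ℓ` on the
component decaying like `e ^ (-ℓ t)`. -/
lemma norm_orbit_le_of_sourceElement {C ω : ℝ} (h : IsBoundedSemigroup S C ω)
    (hS : ∀ q u, fracPow A q u = S q u) (T : X →L[ℝ] X)
    {lam a b ℓ δ : ℝ} (hlam : ω < lam) (ha : 0 ≤ a) (hb : 0 ≤ b) (hℓ : 0 < ℓ) (hδ : 0 < δ)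
    {n : ℕ} {v : X} (hv : v ∈ logPowDomain A n)
    (hbd : ∀ t, 0 ≤ t → Real.exp (-lam * t) * ‖T (S t (sourceElement A lam n v))‖ ≤
      a * Real.exp (-ℓ * t) + b * Real.exp (-δ * t)) {t : ℝ} (ht : 0 ≤ t) :
    Real.exp (-lam * t) * ‖T (S t v)‖ ≤
      a / ℓ ^ n * Real.exp (-ℓ * t) + b / δ ^ n * Real.exp (-δ * t) := by
  induction n generalizing v t with
  | zero => simpa [sourceElement] using hbd t ht
  | succ n ih =>
    have hv' := smul_sub_mem_logPowDomain hS lam (logPowDomain_succ_subset n hv) hv.2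
    have hy : Tendsto (fun q : ℝ => q⁻¹ • (S q v - v)) (𝓝[>] 0) (𝓝 (logOp A v)) := by
      refine (tendsto_logQuotient hv.1).congr fun q => ?_
      rw [logQuotient, hS]
    have := h.norm_orbit_le_of_norm_orbit_sub_le hy T hlam (a := a / ℓ ^ n) (b := b / δ ^ n)
      (by positivity) (by positivity) hℓ hδ (fun s hs => ih hv' hbd hs) ht
    rwa [div_div, div_div, ← pow_succ, ← pow_succ] at this

end Logarithm

/-! ### Choice of the cut-off level and the interpolation estimate -/

/-- Optimisation of the cut-off level `e ^ (-ℓ)`. With `L = log (1 / τ)`, the choice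
`ℓ = (L - n log L) / (p + 1)` balances the two terms of the interpolation estimate as soon as `L`
is so large that `ℓ ≥ L / (2 (p + 1))`; for bounded `L` the a priori bound suffices. -/
lemma exists_const_of_interpolation {p : ℝ} (hp : 0 ≤ p) {n : ℕ} (hn : 1 ≤ n) {C : ℝ}
    (hC : 0 < C) :
    ∃ C' : ℝ, 0 < C' ∧ ∀ U W τ : ℝ, 1 ≤ W → 0 ≤ τ → τ < 1 → U ≤ C * W →
      (∀ ℓ : ℝ, 0 < ℓ → U ≤ C * (Real.exp (-p * ℓ) / ℓ ^ n * W + τ * Real.exp ℓ)) →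
      U ≤ C' * W * (τ ^ (p / (p + 1)) * Real.log (1 / τ) ^ (-((n : ℝ) / (p + 1)))) := by
  have hp1 : 0 < p + 1 := by linarith
  have hn0 : (0 : ℝ) < n := by exact_mod_cast hn
  obtain ⟨Λ, hΛ1, hΛ⟩ : ∃ Λ : ℝ, 1 ≤ Λ ∧ ∀ L, Λ ≤ L → 2 * n * Real.log L ≤ L := by
    have h := Real.isLittleO_log_id_atTop.def (c := 1 / (2 * n)) (by positivity)
    obtain ⟨Λ, hΛ⟩ := eventually_atTop.1 h
    refine ⟨max Λ 1, le_max_right _ _, fun L hL => ?_⟩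
    have h1 := hΛ L ((le_max_left _ _).trans hL)
    have hL1 : 1 ≤ L := (le_max_right _ _).trans hL
    rw [id, Real.norm_of_nonneg (Real.log_nonneg hL1), Real.norm_of_nonneg (by linarith)] at h1
    calc 2 * n * Real.log L ≤ 2 * n * (1 / (2 * n) * L) := by gcongr
      _ = L := by field_simp
  set f₀ : ℝ := Real.exp (-p * Λ / (p + 1) - n / (p + 1) * Real.log Λ) with hf₀
  have hf₀pos : 0 < f₀ := Real.exp_pos _
  refine ⟨C * ((2 * (p + 1)) ^ n + 1) + C / f₀, by positivity, ?_⟩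
  intro U W τ hW hτ0 hτ1 hU hint
  have hW0 : 0 < W := by linarith
  rcases hτ0.eq_or_lt with rfl | hτ
  · -- here `log (1 / 0) = 0`, and the negative power of `0` is `0`
    have hne : -((n : ℝ) / (p + 1)) ≠ 0 := neg_ne_zero.2 (by positivity)
    rw [div_zero, Real.log_zero, Real.zero_rpow hne, mul_zero, mul_zero]
    have h0 : Tendsto (fun ℓ : ℝ => C * W * ℓ⁻¹) atTop (𝓝 0) := by
      simpa using tendsto_inv_atTop_zero.const_mul (C * W)
    refine ge_of_tendsto h0 ?_
    filter_upwards [eventually_ge_atTop 1] with ℓ hℓ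
    have hℓ0 : 0 < ℓ := by linarith
    refine (hint ℓ hℓ0).trans ?_
    rw [zero_mul, add_zero, mul_assoc, mul_comm W]
    gcongr
    rw [inv_eq_one_div]
    gcongr
    · exact Real.exp_le_one_iff.2 (by nlinarith)
    · exact le_self_pow₀ hℓ (by omega)
  · set L := Real.log (1 / τ) with hL
    have hLpos : 0 < L := Real.log_pos (by rw [lt_div_iff₀ hτ]; linarith)
    have hτL : τ = Real.exp (-L) := by
      rw [hL, one_div, Real.log_inv, neg_neg, Real.exp_log hτ]
    have hF : τ ^ (p / (p + 1)) * L ^ (-((n : ℝ) / (p + 1))) =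
        Real.exp (-p * L / (p + 1) - n / (p + 1) * Real.log L) := by
      rw [Real.rpow_def_of_pos hτ, Real.rpow_def_of_pos hLpos, ← Real.exp_add, hτL, Real.log_exp]
      congr 1
      field_simp
      ring
    rw [hF]
    set F := Real.exp (-p * L / (p + 1) - n / (p + 1) * Real.log L) with hFdef
    have hFpos : 0 < F := Real.exp_pos _
    rcases le_total Λ L with hle | hle
    · have hlog := hΛ L hle
      set ℓ := (L - n * Real.log L) / (p + 1) with hℓ
      have hℓL : L / (2 * (p + 1)) ≤ ℓ := by
        rw [hℓ, div_le_div_iff₀ (by positivity) hp1]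
        nlinarith
      have hℓpos : 0 < ℓ := lt_of_lt_of_le (by positivity) hℓL
      have h1 : Real.exp (-p * ℓ) / ℓ ^ n ≤ (2 * (p + 1)) ^ n * F := by
        have hpow : (L / (2 * (p + 1))) ^ n ≤ ℓ ^ n := by gcongr
        have hLn : L ^ n = Real.exp (n * Real.log L) := by
          rw [mul_comm, Real.exp_mul, Real.exp_log hLpos, Real.rpow_natCast]
        calc Real.exp (-p * ℓ) / ℓ ^ n ≤ Real.exp (-p * ℓ) / (L / (2 * (p + 1))) ^ n := by gcongr
          _ = (2 * (p + 1)) ^ n * (Real.exp (-p * ℓ) * (L ^ n)⁻¹) := by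
              rw [div_pow]; field_simp
          _ = (2 * (p + 1)) ^ n * F := by
              rw [hLn, ← Real.exp_neg, ← Real.exp_add, hFdef, hℓ]
              congr 2
              field_simp
              ring
      have h2 : τ * Real.exp ℓ = F := by
        rw [hτL, ← Real.exp_add, hFdef, hℓ]
        congr 1
        field_simp
        ring
      calc U ≤ C * (Real.exp (-p * ℓ) / ℓ ^ n * W + τ * Real.exp ℓ) := hint ℓ hℓpos
        _ ≤ C * ((2 * (p + 1)) ^ n * F * W + F * W) := by
            rw [h2]
            gcongr
            exact le_mul_of_one_le_right hFpos.le hW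
        _ = C * ((2 * (p + 1)) ^ n + 1) * W * F := by ring
        _ ≤ (C * ((2 * (p + 1)) ^ n + 1) + C / f₀) * W * F := by
            gcongr
            exact le_add_of_nonneg_right (by positivity)
    · have hf : f₀ ≤ F := by
        rw [hf₀, hFdef, Real.exp_le_exp]
        have h1 : Real.log L ≤ Real.log Λ := Real.log_le_log hLpos hle
        have h2 : n / (p + 1) * Real.log L ≤ n / (p + 1) * Real.log Λ := by gcongr
        have h3 : -p * Λ / (p + 1) ≤ -p * L / (p + 1) :=
          div_le_div_of_nonneg_right (by nlinarith) hp1.le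
        linarith
      calc U ≤ C * W := hU
        _ = C / f₀ * W * f₀ := by field_simp
        _ ≤ C / f₀ * W * F := by gcongr
        _ ≤ (C * ((2 * (p + 1)) ^ n + 1) + C / f₀) * W * F := by
            gcongr
            exact le_add_of_nonneg_left (by positivity)

lemma IsPositiveTypeWith.isBoundedSemigroup {X : Type*} [NormedAddCommGroup X]
    [NormedSpace ℝ X] [CompleteSpace X] {κ : ℝ} {a : X →L[ℝ] X}
    (h : IsPositiveTypeWith κ a) {ω : ℝ} (hω : ‖a‖ ≤ Real.exp ω) :
    IsBoundedSemigroup (realPow a) ((1 + 2 * κ) * ‖(1 : X →L[ℝ] X)‖) ω where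
  zero := by simp [realPow]
  add _ _ hs ht := h.realPow_add hs ht
  norm_le _ ht := h.norm_realPow_le hω ht

section Operators

variable {𝕜 X : Type*} [RCLike 𝕜] [NormedAddCommGroup X] [NormedSpace 𝕜 X]
    [NormedSpace ℝ X] [IsScalarTower ℝ 𝕜 X] [CompleteSpace X] {A : X →L[𝕜] X}

/-- A positive operator over `𝕜` is a positive element of the real Banach algebra of bounded
real-linear operators, with the same resolvent. -/
lemma IsPositiveType.exists_isPositiveTypeWith (hA : IsPositiveType A) :
    ∃ κ : ℝ, IsPositiveTypeWith κ (A.restrictScalars ℝ) ∧ ∀ s : ℝ, 0 < s → ∀ x : X,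
      Ring.inverse (A + (s : 𝕜) • (1 : X →L[𝕜] X)) x = res (A.restrictScalars ℝ) s x := by
  obtain ⟨κ, -, h⟩ := hA
  have key : ∀ s : ℝ, 0 < s →
      IsUnit (A.restrictScalars ℝ + s • (1 : X →L[ℝ] X)) ∧
      res (A.restrictScalars ℝ) s =
        (Ring.inverse (A + (s : 𝕜) • (1 : X →L[𝕜] X))).restrictScalars ℝ := by
    intro s hs
    have hu : IsUnit (A + (s : 𝕜) • (1 : X →L[𝕜] X)) :=
      ContinuousLinearMap.isUnit_iff_bijective.2 (h s hs).1
    have e : A.restrictScalars ℝ + s • (1 : X →L[ℝ] X) =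
        (A + (s : 𝕜) • (1 : X →L[𝕜] X)).restrictScalars ℝ := by
      ext x
      simp only [add_apply, smul_apply,
        ContinuousLinearMap.coe_restrictScalars', one_apply_eq_self]
      rw [← RCLike.algebraMap_eq_ofReal, algebraMap_smul]
    have h1 : (A.restrictScalars ℝ + s • (1 : X →L[ℝ] X)) *
        (Ring.inverse (A + (s : 𝕜) • (1 : X →L[𝕜] X))).restrictScalars ℝ = 1 := by
      rw [e]
      ext x
      exact DFunLike.congr_fun (Ring.mul_inverse_cancel _ hu) x
    have h2 : (Ring.inverse (A + (s : 𝕜) • (1 : X →L[𝕜] X))).restrictScalars ℝ *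
        (A.restrictScalars ℝ + s • (1 : X →L[ℝ] X)) = 1 := by
      rw [e]
      ext x
      exact DFunLike.congr_fun (Ring.inverse_mul_cancel _ hu) x
    exact ⟨⟨⟨_, _, h1, h2⟩, rfl⟩, Ring.inverse_unit ⟨_, _, h1, h2⟩⟩
  refine ⟨κ, fun s hs => ⟨(key s hs).1, ?_⟩, fun s hs x => ?_⟩
  · rw [(key s hs).2, ContinuousLinearMap.norm_restrictScalars]
    exact (h s hs).2
  · rw [(key s hs).2]; rfl

lemma fracPow_eq_realPow {κ : ℝ} (h : IsPositiveTypeWith κ (A.restrictScalars ℝ))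
    (hres : ∀ s : ℝ, 0 < s → ∀ x : X,
      Ring.inverse (A + (s : 𝕜) • (1 : X →L[𝕜] X)) x = res (A.restrictScalars ℝ) s x)
    (q : ℝ) (u : X) : fracPow A q u = realPow (A.restrictScalars ℝ) q u := by
  have hpow : ∀ n : ℕ, ∀ u : X, (A ^ n) u = (A.restrictScalars ℝ ^ n) u := by
    intro n
    induction n with
    | zero => intro u; rfl
    | succ n ih =>
      intro u
      rw [pow_succ, pow_succ, mul_apply_eq_comp, mul_apply_eq_comp, ih]
      rfl
  unfold fracPow realPow
  split_ifs with hf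
  · exact hpow _ _
  · have hi := h.integrableOn_balakrishnan_one ((Int.fract_nonneg q).lt_of_ne' hf)
      (Int.fract_lt_one q)
    rw [mul_apply_eq_comp, hpow, balakrishnan, balakrishnanPow,
      smul_apply, ContinuousLinearMap.integral_apply hi]
    congr 1
    refine setIntegral_congr_fun measurableSet_Ioi fun s hs => ?_
    simp only [smul_apply, mul_apply_eq_comp]
    rw [hres s hs]
    rfl

/-- The source condition at the level of the cut-off: the smoothing factor `A ^ p` gives `α ^ p`,
and `(lam - log A) ^ (-n)` gives `(log (1 / α)) ^ (-n)`, where `α = e ^ (-ℓ)`. Along the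
semigroup, the cut-off decays like `α ^ t` for `t ≤ 1`; for `t ≥ 1` one extra power of `α`
remains, which is smaller than any negative power of `ℓ`. -/
lemma exists_norm_cutoff_le {κ ω lam p : ℝ} (h : IsPositiveTypeWith κ (A.restrictScalars ℝ))
    (hS : ∀ q u, fracPow A q u = realPow (A.restrictScalars ℝ) q u)
    (hω : ‖A.restrictScalars ℝ‖ ≤ Real.exp ω) (hlam : ω < lam) (hp : 0 ≤ p) (n : ℕ)
    {m : ℕ} (hm : p + 1 < m) :
    ∃ C : ℝ, 0 ≤ C ∧ ∀ ℓ : ℝ, 0 < ℓ → ∀ v ∈ logPowDomain A n,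
      ‖cutoff (A.restrictScalars ℝ) m (Real.exp (-ℓ)) (fracPow A p v)‖ ≤
        C * (Real.exp (-p * ℓ) / ℓ ^ n * ‖sourceElement A lam n v‖) := by
  set a := A.restrictScalars ℝ with ha
  have hκ := h.const_nonneg
  set C₀ := (1 + 2 * κ) * ‖(1 : X →L[ℝ] X)‖ with hC₀
  set C₁ := (1 + 2 * κ) * ((‖(1 : X →L[ℝ] X)‖ + κ + 1) ^ m * ‖(1 : X →L[ℝ] X)‖) with hC₁
  have hC₀0 : 0 ≤ C₀ := by positivity
  have hC₁0 : 0 ≤ C₁ := by positivity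
  set δ := lam - ω with hδ
  have hδ0 : 0 < δ := sub_pos.2 hlam
  have hsemi := h.isBoundedSemigroup hω
  refine ⟨Real.exp |lam| * C₁ + C₀ * Real.exp (-ω) * C₁ / δ ^ n * n.factorial,
    by positivity, ?_⟩
  intro ℓ hℓ v hv
  set w := sourceElement A lam n v with hw
  set α := Real.exp (-ℓ) with hα
  have hα0 : 0 < α := Real.exp_pos _
  have hαpow : ∀ x : ℝ, α ^ x = Real.exp (-ℓ * x) := fun x => by rw [hα, ← Real.exp_mul]
  set T : X →L[ℝ] X := cutoff a m α * realPow a p with hT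
  have hcomm : ∀ q, Commute (cutoff a m α) (realPow a q) := fun q =>
    h.commute_realPow (commute_cutoff a m α).symm q
  have hTS : ∀ t, 0 ≤ t → T * realPow a t = realPow a (p + t) * cutoff a m α := by
    intro t ht
    rw [hT, mul_assoc, ← h.realPow_add hp ht, (hcomm _).eq]
  have hbd : ∀ t, 0 ≤ t → Real.exp (-lam * t) * ‖T (realPow a t w)‖ ≤
      (Real.exp |lam| * C₁ * α ^ p * ‖w‖) * Real.exp (-ℓ * t) +
        (C₀ * Real.exp (-ω) * C₁ * α ^ (p + 1) * ‖w‖) * Real.exp (-δ * t) := by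
    intro t ht
    have hop : ‖T (realPow a t w)‖ ≤ ‖realPow a (p + t) * cutoff a m α‖ * ‖w‖ := by
      rw [← hTS t ht]
      exact (T * realPow a t).le_opNorm w
    rcases le_total t 1 with ht1 | ht1
    · have h1 := h.norm_realPow_mul_cutoff_le hα0 (m := m) (add_nonneg hp ht) (by linarith)
      have h2 : Real.exp (-lam * t) ≤ Real.exp |lam| := by
        rw [Real.exp_le_exp]
        nlinarith [neg_abs_le lam, abs_nonneg lam]
      calc Real.exp (-lam * t) * ‖T (realPow a t w)‖
          ≤ Real.exp |lam| * (C₁ * α ^ (p + t) * ‖w‖) := by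
            gcongr
            exact hop.trans (by gcongr)
        _ = (Real.exp |lam| * C₁ * α ^ p * ‖w‖) * Real.exp (-ℓ * t) := by
            rw [Real.rpow_add hα0, hαpow t]; ring
        _ ≤ _ := le_add_of_nonneg_right (by positivity)
    · have h1 := h.norm_realPow_mul_cutoff_le hα0 (m := m) (q := p + 1) (by linarith) hm
      have h2 : realPow a (p + t) = realPow a (t - 1) * realPow a (p + 1) := by
        rw [← h.realPow_add (by linarith) (by linarith)]
        congr 1; ring
      have h3 : ‖realPow a (p + t) * cutoff a m α‖ ≤
          C₀ * Real.exp (ω * (t - 1)) * (C₁ * α ^ (p + 1)) := by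
        rw [h2, mul_assoc]
        refine (norm_mul_le _ _).trans ?_
        gcongr
        exact h.norm_realPow_le hω (by linarith)
      calc Real.exp (-lam * t) * ‖T (realPow a t w)‖
          ≤ Real.exp (-lam * t) *
              (C₀ * Real.exp (ω * (t - 1)) * (C₁ * α ^ (p + 1)) * ‖w‖) := by
            gcongr
            exact hop.trans (by gcongr)
        _ = C₀ * C₁ * α ^ (p + 1) * ‖w‖ *
              (Real.exp (-lam * t) * Real.exp (ω * (t - 1))) := by ring
        _ = C₀ * C₁ * α ^ (p + 1) * ‖w‖ * (Real.exp (-ω) * Real.exp (-δ * t)) := by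
            rw [← Real.exp_add, ← Real.exp_add, hδ]; ring_nf
        _ = (C₀ * Real.exp (-ω) * C₁ * α ^ (p + 1) * ‖w‖) * Real.exp (-δ * t) := by ring
        _ ≤ _ := le_add_of_nonneg_left (by positivity)
  have hmain := norm_orbit_le_of_sourceElement hsemi hS T hlam (by positivity) (by positivity)
    hℓ hδ0 hv hbd le_rfl
  simp only [mul_zero, Real.exp_zero, one_mul, mul_one, hsemi.zero] at hmain
  have hTv : T ((1 : X →L[ℝ] X) v) = cutoff a m α (fracPow A p v) := by rw [hS]; rfl
  rw [hTv] at hmain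
  -- `e ^ (-ℓ) ≤ n! / ℓ ^ n`, from the exponential series
  have hfact : α ≤ n.factorial / ℓ ^ n := by
    have := Real.pow_div_factorial_le_exp ℓ hℓ.le n
    rw [hα, Real.exp_neg, inv_eq_one_div, div_le_div_iff₀ (Real.exp_pos _) (by positivity), one_mul]
    rw [div_le_iff₀ (by positivity)] at this
    linarith
  have hαp : α ^ p = Real.exp (-p * ℓ) := by rw [hαpow]; ring_nf
  calc ‖cutoff a m α (fracPow A p v)‖
      ≤ Real.exp |lam| * C₁ * α ^ p * ‖w‖ / ℓ ^ n +
          C₀ * Real.exp (-ω) * C₁ * α ^ (p + 1) * ‖w‖ / δ ^ n := hmain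
    _ = Real.exp |lam| * C₁ * α ^ p * ‖w‖ / ℓ ^ n +
          C₀ * Real.exp (-ω) * C₁ * (α ^ p * α) * ‖w‖ / δ ^ n := by
        rw [Real.rpow_add_one hα0.ne']
    _ ≤ Real.exp |lam| * C₁ * α ^ p * ‖w‖ / ℓ ^ n +
          C₀ * Real.exp (-ω) * C₁ * (α ^ p * (n.factorial / ℓ ^ n)) * ‖w‖ / δ ^ n := by gcongr
    _ = _ := by rw [hαp]; ring

/-- The a priori bound `‖A ^ p v‖ ≤ C ‖(lam - log A) ^ n v‖`. -/
lemma exists_norm_fracPow_le {κ ω lam p : ℝ} (h : IsPositiveTypeWith κ (A.restrictScalars ℝ))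
    (hS : ∀ q u, fracPow A q u = realPow (A.restrictScalars ℝ) q u)
    (hω : ‖A.restrictScalars ℝ‖ ≤ Real.exp ω) (hlam : ω < lam) (n : ℕ) :
    ∃ C : ℝ, 0 ≤ C ∧ ∀ v ∈ logPowDomain A n,
      ‖fracPow A p v‖ ≤ C * ‖sourceElement A lam n v‖ := by
  set a := A.restrictScalars ℝ with ha
  have hκ := h.const_nonneg
  set C₀ := (1 + 2 * κ) * ‖(1 : X →L[ℝ] X)‖ with hC₀
  have hC₀0 : 0 ≤ C₀ := by positivity
  have hδ0 : 0 < lam - ω := sub_pos.2 hlam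
  have hsemi := h.isBoundedSemigroup hω
  refine ⟨‖realPow a p‖ * C₀ / (lam - ω) ^ n, by positivity, fun v hv => ?_⟩
  set w := sourceElement A lam n v with hw
  have hmain := norm_orbit_le_of_sourceElement hsemi hS (realPow a p) hlam (a := 0)
    (b := ‖realPow a p‖ * C₀ * ‖w‖) le_rfl (by positivity) one_pos hδ0 hv (fun t ht => by
      rw [zero_mul, zero_add]
      calc Real.exp (-lam * t) * ‖realPow a p (realPow a t w)‖
          ≤ Real.exp (-lam * t) * (‖realPow a p‖ * (C₀ * Real.exp (ω * t) * ‖w‖)) := by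
            gcongr
            refine (ContinuousLinearMap.le_opNorm _ _).trans ?_
            gcongr
            refine (ContinuousLinearMap.le_opNorm _ _).trans ?_
            gcongr
            exact h.norm_realPow_le hω ht
        _ = ‖realPow a p‖ * C₀ * ‖w‖ * (Real.exp (-lam * t) * Real.exp (ω * t)) := by ring
        _ = ‖realPow a p‖ * C₀ * ‖w‖ * Real.exp (-(lam - ω) * t) := by
            rw [← Real.exp_add]; ring_nf) le_rfl
  simp only [mul_zero, Real.exp_zero, one_mul, mul_one, hsemi.zero, zero_div, zero_add] at hmain
  rw [hS]
  exact hmain.trans_eq (by ring)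

end Operators

theorem mainTheorem3 {𝕜 X : Type*} [RCLike 𝕜] [NormedAddCommGroup X] [NormedSpace 𝕜 X]
    [NormedSpace ℝ X] [IsScalarTower ℝ 𝕜 X] [CompleteSpace X]
    (A : X →L[𝕜] X) (hA : IsPositiveType A)
    (p : ℝ) (hp : 0 ≤ p) (ν : ℕ) (hν : 1 ≤ ν)
    (lam : ℝ) (hlam : Real.log ‖A‖ < lam)
    (δ₀ : ℝ) (hδ₀ : 0 < δ₀) (hδ₀' : δ₀ < 1) :
    ∃ C : ℝ, 0 < C ∧ ∀ u v : X, v ∈ logPowDomain A ν → u = fracPow A p v → ‖A u‖ ≤ δ₀ →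
      ‖u‖ ≤ C * max ‖sourceElement A lam ν v‖ 1 *
        (‖A u‖ ^ (p / (p + 1)) * Real.log (1 / ‖A u‖) ^ (-((ν : ℝ) / (p + 1)))) := by
  obtain ⟨κ, h, hres⟩ := hA.exists_isPositiveTypeWith
  have hS := fracPow_eq_realPow h hres
  have hκ := h.const_nonneg
  have hω : ‖A.restrictScalars ℝ‖ ≤ Real.exp (Real.log ‖A‖) := by
    rw [ContinuousLinearMap.norm_restrictScalars]
    -- for `A = 0` this reads `0 ≤ 1`, because `log 0 = 0`
    exact Real.le_exp_log _
  -- the order of the cut-off must exceed `p + 1`, the largest exponent it has to absorb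
  set m := ⌊p⌋₊ + 2 with hm
  have hpm : p + 1 < m := by
    have := Nat.lt_floor_add_one p
    rw [hm]; push_cast; linarith
  obtain ⟨C₁, hC₁, hcut⟩ := exists_norm_cutoff_le h hS hω hlam hp ν hpm
  obtain ⟨C₂, hC₂, hpri⟩ := exists_norm_fracPow_le (p := p) h hS hω hlam ν
  set C₃ := m * ((‖(1 : X →L[ℝ] X)‖ + κ + 1) ^ m * κ) with hC₃
  have hC₃0 : 0 ≤ C₃ := by positivity
  obtain ⟨C, hC, hopt⟩ := exists_const_of_interpolation hp hν
    (C := C₁ + C₂ + C₃ + 1) (by positivity)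
  refine ⟨C, hC, ?_⟩
  rintro u v hv rfl hAu
  set u := fracPow A p v with hu
  set w := sourceElement A lam ν v with hw
  have hW : ‖w‖ ≤ max ‖w‖ 1 := le_max_left _ _
  refine hopt ‖u‖ (max ‖w‖ 1) ‖A u‖ (le_max_right _ _) (norm_nonneg _) (hAu.trans_lt hδ₀')
    ?_ fun ℓ hℓ => ?_
  · refine (hpri v hv).trans ?_
    gcongr
    linarith
  · obtain ⟨y, hy, hyn⟩ := h.exists_one_sub_cutoff_eq m (Real.exp_pos (-ℓ))
    have hsplit : u = cutoff (A.restrictScalars ℝ) m (Real.exp (-ℓ)) u + y (A u) := by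
      have := DFunLike.congr_fun hy u
      exact sub_eq_iff_eq_add'.1 this
    have h1 := hcut ℓ hℓ v hv
    have h2 : ‖y (A u)‖ ≤ C₃ * (‖A u‖ * Real.exp ℓ) := by
      refine (y.le_opNorm _).trans ?_
      rw [Real.exp_neg, div_inv_eq_mul] at hyn
      calc ‖y‖ * ‖A u‖ ≤ C₃ * Real.exp ℓ * ‖A u‖ := by gcongr
        _ = C₃ * (‖A u‖ * Real.exp ℓ) := by ring
    calc ‖u‖ ≤ ‖cutoff (A.restrictScalars ℝ) m (Real.exp (-ℓ)) u‖ + ‖y (A u)‖ := by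
          conv_lhs => rw [hsplit]
          exact norm_add_le _ _
      _ ≤ C₁ * (Real.exp (-p * ℓ) / ℓ ^ ν * max ‖w‖ 1) + C₃ * (‖A u‖ * Real.exp ℓ) := by
          refine add_le_add (h1.trans ?_) h2
          gcongr
      _ ≤ (C₁ + C₂ + C₃ + 1) * (Real.exp (-p * ℓ) / ℓ ^ ν * max ‖w‖ 1) +
            (C₁ + C₂ + C₃ + 1) * (‖A u‖ * Real.exp ℓ) := by
          gcongr <;> linarith
      _ = _ := by ring
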